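/- **Setting.** A sublinear expectation space $(\Omega,\mathcal H,\hat{\mathbb E})$ consists of a set $\Omega$, a linear space $\mathcal H$ of real functions on $\Omega$ such that $\varphi(X_1,\dots,X_n)\in\mathcal H$ whenever $X_1,\dots,X_n\in\mathcal H$ and $\varphi:\mathbb R^n\to\mathbb R$ is Lipschitz, and a functional $\hat{\mathbb E}:\mathcal H\to\mathbb R$ that is monotone, preserves constants, is positively homogeneous, and satisfies $\hat{\mathbb E}[X]-\hat{\mathbb E}[Y]\le\hat{\mathbb E}[X-Y]$. Random vectors $X,X'$ (possibly on different spaces) are identically distributed if $\hat{\mathbb E}[\varphi(X)]=\hat{\mathbb E}'[\varphi(X')]$ for all Lipschitz $\varphi$; $Y$ is independent from $X$ if $\hat{\mathbb E}[\varphi(X,Y)]=\hat{\mathbb E}\big[\hat{\mathbb E}[\varphi(x,Y)]_{x=X}\big]$ for all Lipschitz $\varphi$. A càdlàg process $(X_t)_{t\ge0}$ with $X_t\in\mathcal H^d$ is a Lévy process if $X_0=0$, if for all $t,s>0$ and $0\le t_1\le\dots\le t_n\le t$ the increment $X_{t+s}-X_t$ is independent from $(X_{t_1},\dots,X_{t_n})$,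 and if the distribution of $X_{t+s}-X_t$ does not depend on $t$. A $d$-dimensional Lévy process $X$ is a $G$-Lévy process if there is a $2d$-dimensional Lévy process $(X^c_t,X^d_t)_{t\ge0}$, on the same or on another sublinear expectation space (whose expectation is again written $\hat{\mathbb E}$), such that $X$ and $X^c+X^d$ have the same finite-dimensional distributions and $$\lim_{t\downarrow0}\hat{\mathbb E}[|X^c_t|^3]\,t^{-1}=0,\qquad \hat{\mathbb E}[|X^d_t|]\le Ct\quad(t\ge0)$$ for some constant $C$, where it is understood that $|X^c_t|^3$ belongs to the domain of the expectation for all sufficiently small $t>0$. **Theorem.** Let $(X_t)_{t\ge0}$ be a $d$-dimensional $G$-Lévy process on $(\Omega,\mathcal H,\hat{\mathbb E})$. (i) For every $f\in C_b^3(\mathbb R^d)$ (three times continuously differentiable, bounded together with its derivatives up to order 3) with $f(0)=0$, the limit $$G_X[f(\cdot)]:=\lim_{\delta\downarrow0}\hat{\mathbb E}[f(X_\delta)]\,\delta^{-1}$$ exists in $\mathbb R$. (ii) For every bounded Lipschitz $\varphi:\mathbb R^d\to\mathbb R$, the function $u(t,x)=\hat{\mathbb E}[\varphi(x+X_t)]$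 on $[0,\infty)\times\mathbb R^d$ is a viscosity solution of $$\partial_tu(t,x)-G_X[u(t,x+\cdot)-u(t,x)]=0,\qquad u(0,x)=\varphi(x).$$ That is: $u$ is bounded and continuous, $u(0,\cdot)=\varphi$, and for every $(t,x)\in(0,\infty)\times\mathbb R^d$ and every $\psi\in C_b^{2,3}((0,\infty)\times\mathbb R^d)$ with $\psi(t,x)=u(t,x)$ one has $$\partial_t\psi(t,x)-G_X[\psi(t,x+\cdot)-\psi(t,x)]\le0\quad\text{if }\psi\ge u\text{ on }(0,\infty)\times\mathbb R^d,$$ $$\partial_t\psi(t,x)-G_X[\psi(t,x+\cdot)-\psi(t,x)]\ge0\quad\text{if }\psi\le u\text{ on }(0,\infty)\times\mathbb R^d.$$ Here $\psi\in C_b^{2,3}$ means that $\psi$, $\partial_t\psi$, $\partial_t^2\psi$ and the $x$-derivatives of $\psi$ up to order 3 exist, are jointly continuous, and are bounded on $(0,\infty)\times\mathbb R^d$. -/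

import Mathlib

open Filter Topology
open scoped NNReal

universe u

/-- A function is (globally) Lipschitz. -/
def IsLip {F : Type*} [PseudoMetricSpace F] (φ : F → ℝ) : Prop :=
  ∃ K : ℝ≥0, LipschitzWith K φ

/-- The class `C_{b.Lip}` of bounded Lipschitz functions. -/
def IsBddLip {F : Type*} [PseudoMetricSpace F] (φ : F → ℝ) : Prop :=
  IsLip φ ∧ ∃ M : ℝ, ∀ x, |φ x| ≤ M

/-- A sublinear expectation space `(Ω, H, E)`: `H` is a linear space of real functions on `Ω` that is
stable under Lipschitz functions of finitely many of its elements, and `E` is a sublinear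
expectation on `H`. The functional `E` is written as a function of all `X : Ω → ℝ`, but it is
constrained, and meaningful, on `H` only. -/
structure SublinearExpectationSpace (Ω : Type u) where
  H : Submodule ℝ (Ω → ℝ)
  lip_mem : ∀ (n : ℕ) (X : Fin n → Ω → ℝ), (∀ i, X i ∈ H) →
    ∀ φ : (Fin n → ℝ) → ℝ, IsLip φ → (fun ω => φ (fun i => X i ω)) ∈ H
  E : (Ω → ℝ) → ℝ
  mono : ∀ X ∈ H, ∀ Y ∈ H, (∀ ω, Y ω ≤ X ω) → E Y ≤ E X
  const : ∀ c : ℝ, E (fun _ => c) = c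
  subadd : ∀ X ∈ H, ∀ Y ∈ H, E X - E Y ≤ E (X - Y)
  pos_homog : ∀ X ∈ H, ∀ c : ℝ, 0 ≤ c → E (c • X) = c * E X

namespace SublinearExpectationSpace

/-- `X ∈ H^d`: all coordinates (equivalently, all linear functionals) of `X` belong to `H`. -/
def IsRandomVector {Ω : Type*} (S : SublinearExpectationSpace Ω) {V : Type*}
    [NormedAddCommGroup V] [NormedSpace ℝ V] (X : Ω → V) : Prop :=
  ∀ l : V →L[ℝ] ℝ, (fun ω => l (X ω)) ∈ S.H

/-- `X` and `X'`, possibly on different sublinear expectation spaces, are identically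
distributed. -/
def IdentDist {Ω Ω' : Type*} (S : SublinearExpectationSpace Ω) (S' : SublinearExpectationSpace Ω')
    {F : Type*} [PseudoMetricSpace F] (X : Ω → F) (X' : Ω' → F) : Prop :=
  ∀ φ : F → ℝ, IsLip φ → S.E (fun ω => φ (X ω)) = S'.E (fun ω => φ (X' ω))

/-- `Y` is independent from `X`: `E[φ(X, Y)] = E[E[φ(x, Y)]_{x = X}]` for all Lipschitz `φ`. -/
def IndepFrom {Ω : Type*} (S : SublinearExpectationSpace Ω)
    {F F' : Type*} [PseudoMetricSpace F] [PseudoMetricSpace F'] (Y : Ω → F') (X : Ω → F) : Prop :=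
  ∀ φ : F × F' → ℝ, IsLip φ →
    S.E (fun ω => φ (X ω, Y ω)) = S.E (fun ω => S.E (fun ω' => φ (X ω, Y ω')))

/-- A Lévy process under a sublinear expectation, with values in `V` (which is `ℝ^d` or
`ℝ^d × ℝ^d` below; on a product the maximum norm gives the same Lipschitz functions as the
Euclidean norm). -/
structure IsLevy {Ω : Type*} (S : SublinearExpectationSpace Ω) {V : Type*}
    [NormedAddCommGroup V] [NormedSpace ℝ V] (X : ℝ≥0 → Ω → V) : Prop where
  mem : ∀ t, S.IsRandomVector (X t)
  right_cont : ∀ ω t, Tendsto (fun s => X s ω) (𝓝[>] t) (𝓝 (X t ω))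
  left_lim : ∀ ω t, ∃ l : V, Tendsto (fun s => X s ω) (𝓝[<] t) (𝓝 l)
  zero : ∀ ω, X 0 ω = 0
  indep : ∀ t s : ℝ≥0, 0 < t → 0 < s → ∀ (n : ℕ) (τ : Fin n → ℝ≥0), Monotone τ →
    (∀ i, τ i ≤ t) →
    S.IndepFrom (fun ω => X (t + s) ω - X t ω) (fun ω => fun i => X (τ i) ω)
  stationary : ∀ t t' s : ℝ≥0,
    S.IdentDist S (fun ω => X (t + s) ω - X t ω) (fun ω => X (t' + s) ω - X t' ω)

/-- The pair `(Xc, Xd)` is a Lévy process with values in `V × V` such that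
`lim_{t ↓ 0} E[|Xc_t|³] / t = 0` (in particular `|Xc_t|³ ∈ H` for small `t`), and
`E[|Xd_t|] ≤ C t` for all `t ≥ 0`. -/
structure IsGLevyPair {Ω : Type*} (S : SublinearExpectationSpace Ω) {V : Type*}
    [NormedAddCommGroup V] [NormedSpace ℝ V] (Xc Xd : ℝ≥0 → Ω → V) : Prop where
  levy : S.IsLevy (fun t ω => (Xc t ω, Xd t ω))
  cube_mem : ∀ᶠ t in 𝓝[>] (0 : ℝ≥0), (fun ω => ‖Xc t ω‖ ^ 3) ∈ S.H
  cube_lim : Tendsto (fun t : ℝ≥0 => S.E (fun ω => ‖Xc t ω‖ ^ 3) / (t : ℝ)) (𝓝[>] 0) (𝓝 0)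
  jump_bound : ∃ C : ℝ, ∀ t : ℝ≥0, S.E (fun ω => ‖Xd t ω‖) ≤ C * t

/-- A `G`-Lévy process: a Lévy process `X` which is, in the sense of finite dimensional
distributions, a sum `Xc + Xd` with `(Xc, Xd)` as in `IsGLevyPair`. The pair may live on another
sublinear expectation space; the case of a pointwise decomposition on the same space is
included. -/
structure IsGLevy {Ω : Type u} (S : SublinearExpectationSpace Ω) {V : Type*}
    [NormedAddCommGroup V] [NormedSpace ℝ V] (X : ℝ≥0 → Ω → V) : Prop where
  levy : S.IsLevy X
  decomp : ∃ (Ω' : Type u) (S' : SublinearExpectationSpace Ω') (Xc Xd : ℝ≥0 → Ω' → V),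
    S'.IsGLevyPair Xc Xd ∧
    ∀ (n : ℕ) (τ : Fin n → ℝ≥0),
      S.IdentDist S' (fun ω => fun i => X (τ i) ω) (fun ω => fun i => Xc (τ i) ω + Xd (τ i) ω)

/-- The nonlocal operator `G_X[f] = lim_{δ ↓ 0} E[f(X_δ)] / δ`. -/
noncomputable def generator {Ω : Type*} (S : SublinearExpectationSpace Ω) {V : Type*}
    (X : ℝ≥0 → Ω → V) (f : V → ℝ) : ℝ :=
  limUnder (𝓝[>] (0 : ℝ≥0)) (fun δ => S.E (fun ω => f (X δ ω)) / (δ : ℝ))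

end SublinearExpectationSpace

/-- The class `C_b^k(V)`: `k` times continuously differentiable, with bounded derivatives of all
orders `0, …, k`. -/
def IsCb {V : Type*} [NormedAddCommGroup V] [NormedSpace ℝ V] (k : ℕ) (f : V → ℝ) : Prop :=
  ContDiff ℝ k f ∧ ∀ j ≤ k, ∃ M : ℝ, ∀ x, ‖iteratedFDeriv ℝ j f x‖ ≤ M

/-- The class `C_b^{2,3}((0, ∞) × V)`: functions `ψ(t, x)` that are twice continuously
differentiable in `t` and three times in `x`, all these derivatives (`ψ` itself included) being
jointly continuous and bounded on `(0, ∞) × V`. Values at `t ≤ 0` play no role. -/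
structure IsCb23 {V : Type*} [NormedAddCommGroup V] [NormedSpace ℝ V] (ψ : ℝ → V → ℝ) : Prop where
  contDiff_time : ∀ x, ContDiffOn ℝ 2 (fun t => ψ t x) (Set.Ioi 0)
  contDiff_space : ∀ t, 0 < t → ContDiff ℝ 3 (ψ t)
  time_cont : ∀ k ≤ 2, ContinuousOn
    (fun p : ℝ × V => iteratedDeriv k (fun s => ψ s p.2) p.1) (Set.Ioi 0 ×ˢ Set.univ)
  space_cont : ∀ k ≤ 3, ContinuousOn
    (fun p : ℝ × V => iteratedFDeriv ℝ k (ψ p.1) p.2) (Set.Ioi 0 ×ˢ Set.univ)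
  time_bdd : ∀ k ≤ 2, ∃ M : ℝ, ∀ t, 0 < t → ∀ x, |iteratedDeriv k (fun s => ψ s x) t| ≤ M
  space_bdd : ∀ k ≤ 3, ∃ M : ℝ, ∀ t, 0 < t → ∀ x, ‖iteratedFDeriv ℝ k (ψ t) x‖ ≤ M

/-- Bounded upper semicontinuous viscosity subsolutions on `[0, ∞) × V` of
`∂_t u(t,x) - G[u(t,x+·) - u(t,x)] = 0`, `u(0,·) = φ`. -/
structure IsViscositySubsolution {V : Type*} [NormedAddCommGroup V] [NormedSpace ℝ V]
    (G : (V → ℝ) → ℝ) (φ : V → ℝ) (u : ℝ≥0 → V → ℝ) : Prop where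
  bdd : ∃ M : ℝ, ∀ t x, |u t x| ≤ M
  usc : UpperSemicontinuous (fun p : ℝ≥0 × V => u p.1 p.2)
  init : ∀ x, u 0 x ≤ φ x
  sub : ∀ (t : ℝ≥0) (x : V), 0 < t → ∀ ψ : ℝ → V → ℝ, IsCb23 ψ →
    (∀ (s : ℝ≥0) (y : V), 0 < s → u s y ≤ ψ s y) → ψ t x = u t x →
    deriv (fun s => ψ s x) t - G (fun z => ψ t (x + z) - ψ t x) ≤ 0

/-- Bounded lower semicontinuous viscosity supersolutions on `[0, ∞) × V` of
`∂_t u(t,x) - G[u(t,x+·) - u(t,x)] = 0`, `u(0,·) = φ`. -/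
structure IsViscositySupersolution {V : Type*} [NormedAddCommGroup V] [NormedSpace ℝ V]
    (G : (V → ℝ) → ℝ) (φ : V → ℝ) (u : ℝ≥0 → V → ℝ) : Prop where
  bdd : ∃ M : ℝ, ∀ t x, |u t x| ≤ M
  lsc : LowerSemicontinuous (fun p : ℝ≥0 × V => u p.1 p.2)
  init : ∀ x, φ x ≤ u 0 x
  super : ∀ (t : ℝ≥0) (x : V), 0 < t → ∀ ψ : ℝ → V → ℝ, IsCb23 ψ →
    (∀ (s : ℝ≥0) (y : V), 0 < s → ψ s y ≤ u s y) → ψ t x = u t x →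
    0 ≤ deriv (fun s => ψ s x) t - G (fun z => ψ t (x + z) - ψ t x)

/-- Bounded continuous viscosity solutions on `[0, ∞) × V` of
`∂_t u(t,x) - G[u(t,x+·) - u(t,x)] = 0`, `u(0,·) = φ`. -/
structure IsViscositySolution {V : Type*} [NormedAddCommGroup V] [NormedSpace ℝ V]
    (G : (V → ℝ) → ℝ) (φ : V → ℝ) (u : ℝ≥0 → V → ℝ) : Prop where
  bdd : ∃ M : ℝ, ∀ t x, |u t x| ≤ M
  cont : Continuous (fun p : ℝ≥0 × V => u p.1 p.2)
  sub : IsViscositySubsolution G φ u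
  super : IsViscositySupersolution G φ u

/-! The crux is a small-time estimate: if `g` is `L`-Lipschitz, vanishes at `0` and has a
first-order Taylor remainder at most `L|y|²` there, then `E[g(X_s)] ≤ C L s` for small `s`, with `C`
independent of `g` (`IsGLevy.exists_E_le`). The jump part contributes at most `L E|Xd_s|`, which is
`O(Ls)` by hypothesis. Of the continuous part only `E|Xc_t| → 0` is extracted from the third-moment
condition; the linear rate comes from independence of increments. Means `E[l(Xc_t)]` are additive in
`t` and bounded near `0`, hence `O(t)`. For the remainder take `ρ(x) = √(1+|x|²) - 1`, which
dominates `min(|x|, |x|²)` up to a factor. Quantitative convexity of `ρ` gives `b(t+s) ≥ b(t) +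
b(s)/4 - Ks` for `b(t) = E[ρ(Xc_t)]` and small times; a bounded function with this property is
`O(s)`.

For (i), the mixed difference `f(x+y) - f(x) - f(y)`, as a function of `y`, lies in the above class
with constant `O(|x|)`; three derivatives of `f` are needed for this. Hence `a(t) = E[f(X_t)]`
satisfies `a(t+s) ≤ a(t) + a(s) + C s E|X_t|`. Since `E|X_t| → 0`, `a` is almost subadditive, and a
Fekete argument at `0` makes `a(t)/t` converge.

For (ii), the Markov property gives `u(δ+r, x) = E[u(r, x+X_δ)]`. Replace `u` by the test function,
expand it in time with error `δ(ε + K|X_δ|)`, divide by `δ` and let `δ` tend to `0`, using (i) and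
`E|X_δ| → 0`. -/

theorem IsLip.of_le {F : Type*} [PseudoMetricSpace F] {φ : F → ℝ} (C : ℝ)
    (h : ∀ x y, |φ x - φ y| ≤ C * dist x y) : IsLip φ :=
  ⟨C.toNNReal, LipschitzWith.of_dist_le' fun x y => by rw [Real.dist_eq]; exact h x y⟩

theorem IsLip.exists_le {F : Type*} [PseudoMetricSpace F] {φ : F → ℝ} (h : IsLip φ) :
    ∃ C : ℝ, 0 ≤ C ∧ ∀ x y, |φ x - φ y| ≤ C * dist x y := by
  obtain ⟨K, hK⟩ := h
  exact ⟨K, K.2, fun x y => by simpa [Real.dist_eq] using hK.dist_le_mul x y⟩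

theorem IsLip.comp {F F' : Type*} [PseudoMetricSpace F] [PseudoMetricSpace F'] {φ : F → ℝ}
    (h : IsLip φ) {g : F' → F} {K : ℝ≥0} (hg : LipschitzWith K g) : IsLip (fun x => φ (g x)) := by
  obtain ⟨L, hL⟩ := h
  exact ⟨L * K, hL.comp hg⟩

theorem IsLip.const {F : Type*} [PseudoMetricSpace F] (c : ℝ) : IsLip (fun _ : F => c) :=
  ⟨0, LipschitzWith.const c⟩

theorem IsLip.add {F : Type*} [PseudoMetricSpace F] {φ ψ : F → ℝ} (h : IsLip φ) (h' : IsLip ψ) :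
    IsLip (fun x => φ x + ψ x) := by
  obtain ⟨K, hK⟩ := h
  obtain ⟨L, hL⟩ := h'
  exact ⟨K + L, hK.add hL⟩

theorem IsLip.const_mul {F : Type*} [PseudoMetricSpace F] {φ : F → ℝ} (h : IsLip φ) (c : ℝ) :
    IsLip (fun x => c * φ x) := by
  obtain ⟨C, -, hC⟩ := h.exists_le
  refine IsLip.of_le (|c| * C) fun x y => ?_
  rw [← mul_sub, abs_mul, mul_assoc]
  exact mul_le_mul_of_nonneg_left (hC x y) (abs_nonneg _)

theorem IsLip.norm {V : Type*} [NormedAddCommGroup V] : IsLip (fun x : V => ‖x‖) :=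
  ⟨1, lipschitzWith_one_norm⟩

theorem IsLip.clm {V : Type*} [NormedAddCommGroup V] [NormedSpace ℝ V] (l : V →L[ℝ] ℝ) :
    IsLip (fun x : V => l x) :=
  ⟨_, l.lipschitz⟩

theorem IsLip.const_add {V : Type*} [NormedAddCommGroup V] {φ : V → ℝ} (h : IsLip φ) (x : V) :
    IsLip (fun y => φ (x + y)) :=
  h.comp (K := 1) (LipschitzWith.of_dist_le_mul fun a b => by simp)

/-! ### Calculus of sublinear expectations. -/

namespace SublinearExpectationSpace

section Basic

variable {Ω : Type*} (S : SublinearExpectationSpace Ω) {A B D : Ω → ℝ}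

theorem const_mem (c : ℝ) : (fun _ : Ω => c) ∈ S.H :=
  S.lip_mem 0 (fun _ _ => 0) (fun i => i.elim0) (fun _ => c) (IsLip.const c)

theorem E_add_le (hA : A ∈ S.H) (hB : B ∈ S.H) :
    S.E (fun ω => A ω + B ω) ≤ S.E A + S.E B := by
  have h := S.subadd (A + B) (S.H.add_mem hA hB) B hB
  rw [add_sub_cancel_right] at h
  change S.E (A + B) ≤ _
  linarith

theorem E_sub_le (hA : A ∈ S.H) (hB : B ∈ S.H) :
    S.E A - S.E B ≤ S.E (fun ω => A ω - B ω) :=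
  S.subadd A hA B hB

theorem E_mul (hA : A ∈ S.H) {c : ℝ} (hc : 0 ≤ c) : S.E (fun ω => c * A ω) = c * S.E A :=
  S.pos_homog A hA c hc

theorem mul_mem (hA : A ∈ S.H) (c : ℝ) : (fun ω => c * A ω) ∈ S.H :=
  S.H.smul_mem c hA

theorem E_add_const (hA : A ∈ S.H) (c : ℝ) : S.E (fun ω => A ω + c) = S.E A + c := by
  refine le_antisymm ?_ ?_
  · have := S.E_add_le hA (S.const_mem c)
    rwa [S.const] at this
  · have := S.E_sub_le hA (S.H.add_mem hA (S.const_mem c))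
    simp only [Pi.add_apply, sub_add_cancel_left, S.const] at this
    change S.E A + c ≤ S.E (A + fun _ => c)
    linarith

theorem E_nonneg (hA : A ∈ S.H) (h : ∀ ω, 0 ≤ A ω) : 0 ≤ S.E A := by
  simpa [S.const] using S.mono A hA _ (S.const_mem 0) h

theorem neg_E_neg_le (hA : A ∈ S.H) : -S.E (fun ω => -A ω) ≤ S.E A := by
  have := S.E_add_le hA (S.H.neg_mem hA)
  simp only [Pi.neg_apply, add_neg_cancel, S.const] at this
  change -S.E (-A) ≤ _
  linarith

theorem abs_E_sub_le (hA : A ∈ S.H) (hB : B ∈ S.H) (hD : D ∈ S.H)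
    (h : ∀ ω, |A ω - B ω| ≤ D ω) : |S.E A - S.E B| ≤ S.E D := by
  rw [abs_sub_le_iff]
  constructor
  · exact (S.E_sub_le hA hB).trans
      (S.mono _ hD _ (S.H.sub_mem hA hB) fun ω => (le_abs_self _).trans (h ω))
  · exact (S.E_sub_le hB hA).trans
      (S.mono _ hD _ (S.H.sub_mem hB hA) fun ω => by
        have := (neg_le_abs _).trans (h ω); linarith)

theorem sum_mem {ι : Type*} (s : Finset ι) {f : ι → Ω → ℝ} (hf : ∀ i, f i ∈ S.H) :
    (fun ω => ∑ i ∈ s, f i ω) ∈ S.H := by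
  have := S.H.sum_mem (t := s) fun i _ => hf i
  convert this using 1
  ext ω
  simp

theorem E_sum_le {ι : Type*} (s : Finset ι) {f : ι → Ω → ℝ} (hf : ∀ i, f i ∈ S.H) :
    S.E (fun ω => ∑ i ∈ s, f i ω) ≤ ∑ i ∈ s, S.E (f i) := by
  classical
  induction s using Finset.induction_on with
  | empty => simp [S.const]
  | insert a s ha ih =>
    simp only [Finset.sum_insert ha]
    exact (S.E_add_le (hf a) (S.sum_mem s hf)).trans (by linarith)

variable {V U : Type*} [NormedAddCommGroup V] [NormedSpace ℝ V] [NormedAddCommGroup U]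
  [NormedSpace ℝ U]

variable {S} in
theorem IsRandomVector.lip_mem [FiniteDimensional ℝ V] {X : Ω → V} (hX : S.IsRandomVector X)
    {φ : V → ℝ} (hφ : IsLip φ) : (fun ω => φ (X ω)) ∈ S.H := by
  let e : V ≃L[ℝ] (Fin (Module.finrank ℝ V) → ℝ) := ContinuousLinearEquiv.ofFinrankEq (by simp)
  have := S.lip_mem _ (fun i ω => e (X ω) i)
    (fun i => hX ((ContinuousLinearMap.proj (R := ℝ) (φ := fun _ => ℝ) i).comp
      (e : V →L[ℝ] (Fin (Module.finrank ℝ V) → ℝ))))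
    (fun y => φ (e.symm y)) (hφ.comp e.symm.lipschitz)
  simpa using this

variable {S} in
theorem IsRandomVector.map {X : Ω → V} (hX : S.IsRandomVector X) (l : V →L[ℝ] U) :
    S.IsRandomVector (fun ω => l (X ω)) :=
  fun k => hX (k.comp l)

variable {S} in
-- Averaging translates preserves the Lipschitz constant. This keeps the inner function of a nested
-- expectation Lipschitz, so that its value at a random vector lies in `H`.
theorem IsRandomVector.isLip_E_add [FiniteDimensional ℝ V] {Y : Ω → V} (hY : S.IsRandomVector Y)
    {f : V → ℝ} (hf : IsLip f) : IsLip (fun x => S.E (fun ω => f (x + Y ω))) := by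
  obtain ⟨C, -, hC⟩ := hf.exists_le
  refine IsLip.of_le C fun x y => ?_
  rw [← S.const (C * dist x y)]
  refine S.abs_E_sub_le (hY.lip_mem (hf.const_add x)) (hY.lip_mem (hf.const_add y))
    (S.const_mem _) fun ω => ?_
  simpa using hC (x + Y ω) (y + Y ω)

end Basic

/-! ### Linear images and the Markov property of Lévy processes. -/

section Levy

variable {Ω : Type*} {S : SublinearExpectationSpace Ω} {V U : Type*} [NormedAddCommGroup V]
  [NormedSpace ℝ V] [NormedAddCommGroup U] [NormedSpace ℝ U] {X : ℝ≥0 → Ω → V}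

theorem IsLevy.map (hX : S.IsLevy X) (l : V →L[ℝ] U) : S.IsLevy (fun t ω => l (X t ω)) where
  mem t := (hX.mem t).map l
  right_cont ω t := (l.continuous.tendsto _).comp (hX.right_cont ω t)
  left_lim ω t := by
    obtain ⟨x, hx⟩ := hX.left_lim ω t
    exact ⟨l x, (l.continuous.tendsto _).comp hx⟩
  zero ω := by simp [hX.zero]
  indep t s ht hs n τ hτ hτt φ hφ := by
    have hl : LipschitzWith ‖l‖₊ (fun x : Fin n → V => fun i => l (x i)) := by
      refine LipschitzWith.of_dist_le_mul fun x y => ?_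
      refine (dist_pi_le_iff (by positivity)).2 fun i => ?_
      exact (l.lipschitz.dist_le_mul _ _).trans
        (mul_le_mul_of_nonneg_left (dist_le_pi_dist x y i) (by positivity))
    have := hX.indep t s ht hs n τ hτ hτt _
      (hφ.comp ((hl.comp LipschitzWith.prod_fst).prodMk (l.lipschitz.comp LipschitzWith.prod_snd)))
    simpa using this
  stationary t t' s φ hφ := by
    have := hX.stationary t t' s _ (hφ.comp l.lipschitz)
    simpa using this

/-- The Markov property of a Lévy process. -/
theorem IsLevy.E_add (hX : S.IsLevy X) (t s : ℝ≥0) {f : V → ℝ} (hf : IsLip f) :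
    S.E (fun ω => f (X (t + s) ω)) = S.E (fun ω => S.E (fun ω' => f (X t ω + X s ω'))) := by
  -- Independence is assumed only for strictly positive times.
  rcases eq_or_lt_of_le (zero_le (a := t)) with rfl | ht
  · simp [hX.zero, S.const]
  rcases eq_or_lt_of_le (zero_le (a := s)) with rfl | hs
  · simp [hX.zero, S.const]
  have hadd : LipschitzWith (1 + 1) (fun p : (Fin 1 → V) × V => p.1 0 + p.2) := by
    refine LipschitzWith.add ?_ LipschitzWith.prod_snd
    refine LipschitzWith.of_dist_le_mul fun x y => ?_
    rw [NNReal.coe_one, one_mul]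
    exact (dist_le_pi_dist x.1 y.1 0).trans (le_max_left _ (dist x.2 y.2))
  have h := hX.indep t s ht hs 1 (fun _ => t) monotone_const (fun _ => le_rfl) _ (hf.comp hadd)
  simp only [add_sub_cancel] at h
  rw [h]
  congr 1
  ext ω
  have h' := hX.stationary t 0 s _ (hf.const_add (X t ω))
  simpa [hX.zero] using h'

end Levy

end SublinearExpectationSpace

/-- Iterating the inequality gives `n (c b(s) - K s) ≤ b(ns) ≤ B`; with `n` of order `ε / s` this
reads `c b(s) ≤ K s + O(s)`. -/
theorem exists_le_mul_of_superadditive {b : ℝ≥0 → ℝ} {ε : ℝ≥0} (hε : 0 < ε) {c K B : ℝ}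
    (hc : 0 < c) (h0 : b 0 = 0) (hB : ∀ t ≤ ε, b t ≤ B)
    (h : ∀ t s, t + s ≤ ε → b t + c * b s - K * s ≤ b (t + s)) :
    ∃ C : ℝ, 0 ≤ C ∧ ∀ s ≤ ε, b s ≤ C * s := by
  have hB0 : 0 ≤ B := h0 ▸ hB 0 hε.le
  have hε' : (0 : ℝ) < ε := hε
  refine ⟨(|K| + 2 * B / ε) / c, by positivity, fun s hs => ?_⟩
  rcases eq_or_lt_of_le (zero_le (a := s)) with rfl | hs0
  · simp [h0]
  have hs0' : (0 : ℝ) < s := hs0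
  have key : ∀ n : ℕ, n * s ≤ ε → n * (c * b s - K * s) ≤ b (n * s) := by
    intro n
    induction n with
    | zero => intro _; simp [h0]
    | succ n ih =>
      intro hn
      push_cast at hn ⊢
      rw [add_mul, one_mul] at hn ⊢
      have h1 := h (n * s) s hn
      have h2 := ih (le_self_add.trans hn)
      rw [add_mul (n : ℝ≥0), one_mul]
      linarith
  set n := ⌊(ε : ℝ) / s⌋₊ with hn
  have hn1 : (1 : ℝ) ≤ n := by
    have : 1 ≤ n := (Nat.one_le_floor_iff _).2 ((one_le_div hs0').2 hs)
    exact_mod_cast this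
  have hn2 : (n : ℝ) * s ≤ ε := by
    have := Nat.floor_le (div_nonneg hε'.le hs0'.le)
    rwa [le_div_iff₀ hs0'] at this
  have hn3 : (ε : ℝ) < (n + 1) * s := by
    have := Nat.lt_floor_add_one ((ε : ℝ) / s)
    rwa [div_lt_iff₀ hs0'] at this
  have hk := (key n (by exact_mod_cast hn2)).trans (hB _ (by exact_mod_cast hn2))
  have h3 : c * b s - K * s ≤ B / n := by
    rw [le_div_iff₀ (by linarith)]; linarith
  have h4 : B / n ≤ 2 * B / ε * s := by
    rw [div_mul_eq_mul_div, div_le_div_iff₀ (by linarith) hε']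
    -- Since `n ≥ 1`, `n + 1 ≤ 2n`.
    have : (ε : ℝ) ≤ 2 * s * n := by nlinarith
    nlinarith
  have h5 : K * s ≤ |K| * s := mul_le_mul_of_nonneg_right (le_abs_self K) hs0'.le
  rw [div_mul_eq_mul_div, le_div_iff₀ hc]
  nlinarith

/-! ### Quantitative convexity of `√(1+‖x‖²) - 1`. -/

section SqrtNorm

variable {V : Type*} [NormedAddCommGroup V]

/-- A convex Lipschitz function that behaves like `‖x‖²` near `0` and like `‖x‖` near infinity. -/
noncomputable def softNorm (x : V) : ℝ := √(1 + ‖x‖ ^ 2) - 1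

theorem softNorm_nonneg (x : V) : 0 ≤ softNorm x := by
  rw [softNorm, sub_nonneg, Real.one_le_sqrt]
  nlinarith [sq_nonneg ‖x‖]

theorem softNorm_le (x : V) : softNorm x ≤ ‖x‖ := by
  rw [softNorm, sub_le_iff_le_add, Real.sqrt_le_left (by positivity)]
  nlinarith [norm_nonneg x]

theorem softNorm_isLip : IsLip (softNorm : V → ℝ) := by
  refine IsLip.of_le 1 fun x y => ?_
  have key : ∀ x y : V, softNorm x - softNorm y ≤ dist x y := fun x y => by
    have h := norm_le_norm_add_norm_sub' x y
    rw [dist_eq_norm]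
    set d := ‖x - y‖
    have hd : 0 ≤ d := norm_nonneg _
    have h1 : √(1 + ‖y‖ ^ 2) ^ 2 = 1 + ‖y‖ ^ 2 := Real.sq_sqrt (by positivity)
    have h2 : ‖y‖ ≤ √(1 + ‖y‖ ^ 2) := Real.le_sqrt_of_sq_le (by linarith)
    have : √(1 + ‖x‖ ^ 2) ≤ √(1 + ‖y‖ ^ 2) + d := by
      rw [Real.sqrt_le_left (by positivity)]
      nlinarith [norm_nonneg x, norm_nonneg y, mul_le_mul_of_nonneg_right h2 hd]
    unfold softNorm
    linarith
  rw [one_mul, abs_sub_le_iff]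
  exact ⟨key x y, dist_comm x y ▸ key y x⟩

/-- Amounts to `min(‖x‖, ‖x‖²) ≤ 3 softNorm x`, obtained by splitting at `‖x‖ = 1`. -/
theorem le_softNorm {L : ℝ} (hL : 0 ≤ L) {r : ℝ} (x : V) (h1 : r ≤ L * ‖x‖)
    (h2 : r ≤ L * ‖x‖ ^ 2) : r ≤ 3 * L * softNorm x := by
  have h : ‖x‖ ≤ 3 * softNorm x ∨ ‖x‖ ^ 2 ≤ 3 * softNorm x := by
    unfold softNorm
    rcases le_total ‖x‖ 1 with hx | hx
    · right
      have : 1 + ‖x‖ ^ 2 / 3 ≤ √(1 + ‖x‖ ^ 2) := Real.le_sqrt_of_sq_le (by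
        nlinarith [norm_nonneg x, sq_nonneg ‖x‖, mul_le_mul hx hx (norm_nonneg x) zero_le_one])
      linarith
    · left
      have : 1 + ‖x‖ / 3 ≤ √(1 + ‖x‖ ^ 2) := Real.le_sqrt_of_sq_le (by nlinarith)
      linarith
  rcases h with h | h
  · nlinarith [mul_le_mul_of_nonneg_left h hL]
  · nlinarith [mul_le_mul_of_nonneg_left h hL]

/-- The linear term is the gradient at `x`, so the claim bounds the convexity gap from below. With
`A`, `B`, `D` the roots belonging to `x`, `x + y`, `y` and `P = 1 + ⟪x, x+y⟫`, `A` times the gap is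
`AB - P`. Cauchy–Schwarz gives `(AB - P)(AB + P) ≥ ‖y‖² = (D-1)(D+1)`, and `AB + P ≤ 2AB`. -/
theorem softNorm_add_ge [InnerProductSpace ℝ V] (x y : V) :
    softNorm x + inner ℝ ((√(1 + ‖x‖ ^ 2))⁻¹ • x) y + (1 / 2 - 3 / 2 * ‖x‖) * softNorm y ≤
      softNorm (x + y) := by
  have hz := norm_add_sq_real x y
  have hz0 := norm_nonneg (x + y)
  have hcs := real_inner_mul_inner_self_le x y
  have hxy := norm_add_le x y
  have hx := norm_nonneg x
  have hy := norm_nonneg y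
  rw [real_inner_smul_left]
  rw [real_inner_self_eq_norm_sq, real_inner_self_eq_norm_sq] at hcs
  unfold softNorm
  generalize inner ℝ x y = i at *
  generalize ‖x + y‖ = z at *
  generalize ‖x‖ = r at *
  generalize ‖y‖ = w at *
  have hA := Real.sq_sqrt (show 0 ≤ 1 + r ^ 2 by positivity)
  have hB := Real.sq_sqrt (show 0 ≤ 1 + z ^ 2 by positivity)
  have hD := Real.sq_sqrt (show 0 ≤ 1 + w ^ 2 by positivity)
  have hA1 : 1 ≤ √(1 + r ^ 2) := Real.one_le_sqrt.2 (by nlinarith)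
  have hB1 : 1 ≤ √(1 + z ^ 2) := Real.one_le_sqrt.2 (by nlinarith)
  have hD1 : 1 ≤ √(1 + w ^ 2) := Real.one_le_sqrt.2 (by nlinarith)
  generalize √(1 + r ^ 2) = A at *
  generalize √(1 + z ^ 2) = B at *
  generalize √(1 + w ^ 2) = D at *
  have hA0 : 0 < A := by linarith
  -- `A * B` dominates `1 + ⟪x, x + y⟫`, quantitatively
  have hP : w ^ 2 ≤ (A * B - (1 + r ^ 2 + i)) * (A * B + (1 + r ^ 2 + i)) := by
    have : (A * B - (1 + r ^ 2 + i)) * (A * B + (1 + r ^ 2 + i))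
        = A ^ 2 * B ^ 2 - (1 + r ^ 2 + i) ^ 2 := by ring
    rw [this, hA, hB, hz]
    nlinarith
  have hAB : 1 + r ^ 2 + i ≤ A * B := by
    refine (abs_le_of_sq_le_sq' ?_ (by positivity)).2
    nlinarith [sq_nonneg w]
  have hconv : 0 ≤ A * B - (1 + r ^ 2 + i) := by linarith
  have hgoal : A * (A - 1 + A⁻¹ * i + (1 / 2 - 3 / 2 * r) * (D - 1)) ≤ A * (B - 1) := by
    have : A * (A - 1 + A⁻¹ * i + (1 / 2 - 3 / 2 * r) * (D - 1))
        = A ^ 2 - A + i + A * ((1 / 2 - 3 / 2 * r) * (D - 1)) := by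
      field_simp
    rw [this, hA]
    suffices A * ((1 / 2 - 3 / 2 * r) * (D - 1)) ≤ A * B - (1 + r ^ 2 + i) by linarith
    -- For `r ≥ 1/3` the coefficient of `D - 1` is nonpositive and plain convexity suffices.
    rcases le_total (1 / 3) r with hr | hr
    · refine le_trans ?_ hconv
      exact mul_nonpos_of_nonneg_of_nonpos hA0.le
        (mul_nonpos_of_nonpos_of_nonneg (by linarith) (by linarith))
    have hBD : B ≤ (1 + r) * D := by
      refine (abs_le_of_sq_le_sq' ?_ (by positivity)).2
      rw [mul_pow, hB, hD]
      nlinarith [mul_nonneg hx (sq_nonneg (w - 1)), mul_nonneg hx (sq_nonneg w),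
        mul_nonneg (sq_nonneg r) (sq_nonneg w), mul_self_le_mul_self hz0 hxy]
    have h1 : (D - 1) * (D + 1) ≤ (A * B - (1 + r ^ 2 + i)) * (2 * (A * B)) := by
      have h : A * B + (1 + r ^ 2 + i) ≤ 2 * (A * B) := by linarith
      refine le_trans ?_ (mul_le_mul_of_nonneg_left h hconv)
      linarith
    have h2 : A ^ 2 * B * (1 - 3 * r) ≤ D + 1 := by
      have h3 : (1 + r ^ 2) * (1 - 3 * r) * B ≤ (1 + r ^ 2) * (1 - 3 * r) * ((1 + r) * D) :=
        mul_le_mul_of_nonneg_left hBD (mul_nonneg (by positivity) (by linarith))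
      have h4 : (1 + r ^ 2) * (1 - 3 * r) * (1 + r) ≤ 1 := by
        nlinarith [pow_nonneg hx 2, pow_nonneg hx 3, pow_nonneg hx 4]
      have h5 := mul_le_mul_of_nonneg_right h4 (show 0 ≤ D by linarith)
      rw [hA]
      linarith
    have h6 := mul_le_mul_of_nonneg_left h2 (show 0 ≤ D - 1 by linarith)
    have hAB0 : 0 < 2 * (A * B) := by positivity
    refine le_of_mul_le_mul_right ?_ hAB0
    linarith
  have := le_of_mul_le_mul_left hgoal hA0
  linarith

end SqrtNorm

/-! ### Moment bounds linear in time. -/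

namespace SublinearExpectationSpace

variable {Ω : Type*} {S : SublinearExpectationSpace Ω}

section Moments

variable {V : Type*} [NormedAddCommGroup V] {X : ℝ≥0 → Ω → V}

/-- Additivity of the mean makes it locally linear in time. -/
theorem IsLevy.exists_E_clm_le [NormedSpace ℝ V] [FiniteDimensional ℝ V] (hX : S.IsLevy X)
    {ε : ℝ≥0} (hε : 0 < ε) (hb : ∀ t ≤ ε, S.E (fun ω => ‖X t ω‖) ≤ 1) (l : V →L[ℝ] ℝ) :
    ∃ C : ℝ, 0 ≤ C ∧ ∀ s ≤ ε, S.E (fun ω => l (X s ω)) ≤ C * s := by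
  refine exists_le_mul_of_superadditive (b := fun t => S.E (fun ω => l (X t ω))) hε (c := 1)
    (K := 0) (B := ‖l‖) one_pos (by simp [hX.zero, S.const]) (fun t ht => ?_) fun t s _ => ?_
  · have h1 := S.mono _ (S.mul_mem ((hX.mem t).lip_mem IsLip.norm) ‖l‖) _
      ((hX.mem t).lip_mem (IsLip.clm l)) fun ω => (le_abs_self _).trans (l.le_opNorm _)
    rw [S.E_mul ((hX.mem t).lip_mem IsLip.norm) (norm_nonneg _)] at h1
    exact h1.trans (by simpa using mul_le_mul_of_nonneg_left (hb t ht) (norm_nonneg l))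
  · rw [hX.E_add t s (IsLip.clm l)]
    have h : ∀ ω, S.E (fun ω' => l (X t ω + X s ω')) = l (X t ω) + S.E (fun ω' => l (X s ω')) := by
      intro ω
      rw [add_comm, ← S.E_add_const ((hX.mem s).lip_mem (IsLip.clm l))]
      simp [add_comm]
    simp only [h]
    rw [S.E_add_const ((hX.mem t).lip_mem (IsLip.clm l))]
    simp

variable [InnerProductSpace ℝ V] [FiniteDimensional ℝ V]

/-- Expand `v` in an orthonormal basis. Both `b i` and `-b i` need a bound, since `E` is only
positively homogeneous and the coefficients have either sign. -/
theorem IsLevy.exists_E_inner_le (hX : S.IsLevy X) {ε : ℝ≥0} (hε : 0 < ε)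
    (hb : ∀ t ≤ ε, S.E (fun ω => ‖X t ω‖) ≤ 1) :
    ∃ C : ℝ, 0 ≤ C ∧ ∀ v : V, ∀ s ≤ ε, S.E (fun ω => inner ℝ v (X s ω)) ≤ C * ‖v‖ * s := by
  let b := stdOrthonormalBasis ℝ V
  choose C hC0 hC using fun i => hX.exists_E_clm_le hε hb (innerSL ℝ (b i))
  choose C' hC0' hC' using fun i => hX.exists_E_clm_le hε hb (-innerSL ℝ (b i))
  refine ⟨∑ i, (C i + C' i), Finset.sum_nonneg fun i _ => add_nonneg (hC0 i) (hC0' i),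
    fun v s hs => ?_⟩
  have hmem : ∀ l : V →L[ℝ] ℝ, (fun ω => l (X s ω)) ∈ S.H := hX.mem s
  have h1 := S.E_sum_le Finset.univ
    (f := fun i ω => inner ℝ v (b i) * innerSL ℝ (b i) (X s ω)) fun i => S.mul_mem (hmem _) _
  simp only [innerSL_apply_apply, b.sum_inner_mul_inner] at h1
  refine h1.trans ?_
  rw [Finset.sum_mul, Finset.sum_mul]
  refine Finset.sum_le_sum fun i _ => ?_
  have hv : |inner ℝ v (b i)| ≤ ‖v‖ := by
    simpa [b.orthonormal.1 i] using abs_real_inner_le_norm v (b i)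
  have h2 := hC i s hs
  have h3 := hC' i s hs
  have hCs := mul_nonneg (hC0 i) s.2
  have hCs' := mul_nonneg (hC0' i) s.2
  simp only [NNReal.val_eq_coe] at hCs hCs'
  have key : ∀ (l : V →L[ℝ] ℝ) (c : ℝ), 0 ≤ c → c ≤ ‖v‖ → ∀ D : ℝ, 0 ≤ D * s →
      S.E (fun ω => l (X s ω)) ≤ D * s → S.E (fun ω => c * l (X s ω)) ≤ ‖v‖ * (D * s) := by
    intro l c hc hcv D hD h
    rw [S.E_mul (hmem l) hc]
    exact (mul_le_mul_of_nonneg_left h hc).trans (mul_le_mul_of_nonneg_right hcv hD)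
  rcases le_total 0 (inner ℝ v (b i)) with h0 | h0
  · have := key _ _ h0 ((le_abs_self _).trans hv) _ hCs h2
    simp only [innerSL_apply_apply] at this
    nlinarith [norm_nonneg v]
  · have := key _ _ (neg_nonneg.2 h0) ((neg_le_abs _).trans hv) _ hCs' h3
    simp only [neg_mul, neg_apply, innerSL_apply_apply, mul_neg,
      neg_neg] at this
    nlinarith [norm_nonneg v]

/-- Conditioning on `X_t` in the convexity inequality makes `E[softNorm(X_t)]` superadditive up to a
factor `1/4` and an error `K s` from the gradient term. -/
theorem IsLevy.exists_E_softNorm_le (hX : S.IsLevy X) {ε : ℝ≥0} (hε : 0 < ε)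
    (hb : ∀ t ≤ ε, S.E (fun ω => ‖X t ω‖) ≤ 1 / 6) :
    ∃ C : ℝ, 0 ≤ C ∧ ∀ s ≤ ε, S.E (fun ω => softNorm (X s ω)) ≤ C * s := by
  obtain ⟨K, hK0, hK⟩ := hX.exists_E_inner_le hε fun t ht => (hb t ht).trans (by norm_num)
  have hsoft : ∀ t, (fun ω => softNorm (X t ω)) ∈ S.H := fun t =>
    (hX.mem t).lip_mem softNorm_isLip
  have hnorm : ∀ t, (fun ω => ‖X t ω‖) ∈ S.H := fun t => (hX.mem t).lip_mem IsLip.norm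
  refine exists_le_mul_of_superadditive (b := fun t => S.E (fun ω => softNorm (X t ω))) hε
    (c := 1 / 4) (K := K) (B := 1 / 6) (by norm_num) (by simp [hX.zero, softNorm, S.const])
    (fun t ht => (S.mono _ (hnorm t) _ (hsoft t) fun ω => softNorm_le _).trans (hb t ht))
    fun t s hts => ?_
  have hs : s ≤ ε := le_add_self.trans hts
  have ht : t ≤ ε := le_self_add.trans hts
  set β := S.E (fun ω => softNorm (X s ω)) with hβ
  have hβ0 : 0 ≤ β := S.E_nonneg (hsoft s) fun ω => softNorm_nonneg _
  rw [hX.E_add t s softNorm_isLip]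
  have hinner : ∀ x : V, softNorm x + (-(3 / 2 * β)) * ‖x‖ + (1 / 2 * β - K * s) ≤
      S.E (fun ω => softNorm (x + X s ω)) := by
    intro x
    have hxmem := (hX.mem s).lip_mem (softNorm_isLip.const_add x)
    set v : V := (√(1 + ‖x‖ ^ 2))⁻¹ • x with hv
    have hA : 0 < √(1 + ‖x‖ ^ 2) := by positivity
    have hv1 : ‖-v‖ ≤ 1 := by
      rw [norm_neg, hv, norm_smul, norm_inv, Real.norm_of_nonneg hA.le, inv_mul_le_iff₀ hA, mul_one]
      exact Real.le_sqrt_of_sq_le (by linarith)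
    have hvmem : (fun ω => inner ℝ (-v) (X s ω)) ∈ S.H := hX.mem s (innerSL ℝ (-v))
    have hvE : S.E (fun ω => inner ℝ (-v) (X s ω)) ≤ K * s := by
      refine (hK (-v) s hs).trans (mul_le_mul_of_nonneg_right ?_ s.2)
      exact mul_le_of_le_one_right hK0 hv1
    have hsum := S.E_add_le hxmem hvmem
    have hadd : ∀ ω, softNorm x + (1 / 2 - 3 / 2 * ‖x‖) * softNorm (X s ω) ≤
        softNorm (x + X s ω) + inner ℝ (-v) (X s ω) := fun ω => by
      have := softNorm_add_ge x (X s ω)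
      rw [inner_neg_left]
      linarith
    -- A negative coefficient cannot be pulled out of `E`; that term is moved to the other side
    -- first.
    rcases le_total 0 (1 / 2 - 3 / 2 * ‖x‖) with hκ | hκ
    · have h1 := S.mono _ (S.H.add_mem hxmem hvmem) _
        (S.H.add_mem (S.mul_mem (hsoft s) (1 / 2 - 3 / 2 * ‖x‖)) (S.const_mem (softNorm x)))
        fun ω => by simpa [add_comm] using hadd ω
      have h2 := S.E_add_const (S.mul_mem (hsoft s) (1 / 2 - 3 / 2 * ‖x‖)) (softNorm x)
      rw [S.E_mul (hsoft s) hκ] at h2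
      change S.E (fun ω => _ + _) ≤ S.E (fun ω => _ + _) at h1
      linarith
    · have hm := S.mul_mem (hsoft s) (-(1 / 2 - 3 / 2 * ‖x‖))
      have h1 := S.mono _ (S.H.add_mem (S.H.add_mem hxmem hvmem) hm) _ (S.const_mem (softNorm x))
        fun ω => by
          have := hadd ω
          simp only [Pi.add_apply]
          linarith
      have h2 := S.E_add_le (S.H.add_mem hxmem hvmem) hm
      rw [S.E_mul (hsoft s) (neg_nonneg.2 hκ)] at h2
      rw [S.const] at h1
      have h3 := h1.trans h2
      change _ ≤ S.E (fun ω => _ + _) + _ at h3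
      linarith
  have hL : IsLip (fun x : V => softNorm x + (-(3 / 2 * β)) * ‖x‖) :=
    softNorm_isLip.add (IsLip.norm.const_mul _)
  have hLm := (hX.mem t).lip_mem hL
  have h1 := S.mono _ ((hX.mem t).lip_mem ((hX.mem s).isLip_E_add softNorm_isLip)) _
    ((hX.mem t).lip_mem (hL.add (IsLip.const _))) fun ω => hinner (X t ω)
  rw [S.E_add_const hLm] at h1
  refine le_trans ?_ h1
  have h2 := S.E_sub_le (hsoft t) (S.mul_mem (hnorm t) (3 / 2 * β))
  rw [S.E_mul (hnorm t) (by positivity)] at h2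
  -- The threshold `1/6` makes the loss `(3/2) β E‖X_t‖` at most `β/4`, which leaves `β/4` of the
  -- gain `β/2`.
  have h3 := mul_le_mul_of_nonneg_left (hb t ht) hβ0
  simp only [neg_mul, ← sub_eq_add_neg]
  linarith

end Moments

end SublinearExpectationSpace

/-! ### Taylor bounds for `C_b^3` functions. -/

theorem norm_sub_sub_fderiv_le {V : Type*} [NormedAddCommGroup V] [NormedSpace ℝ V] {k : V → ℝ}
    (hk : Differentiable ℝ k) {L : ℝ} (hL0 : 0 ≤ L)
    (hL : ∀ y, ‖fderiv ℝ k y - fderiv ℝ k 0‖ ≤ L * ‖y‖) (y : V) :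
    |k y - k 0 - fderiv ℝ k 0 y| ≤ L * ‖y‖ ^ 2 := by
  have := (convex_closedBall (0 : V) ‖y‖).norm_image_sub_le_of_norm_fderiv_le' (𝕜 := ℝ)
    (f := k) (φ := fderiv ℝ k 0) (C := L * ‖y‖) (fun x _ => hk x)
    (fun x hx => (hL x).trans (mul_le_mul_of_nonneg_left (by simpa using hx) hL0))
    (Metric.mem_closedBall_self (norm_nonneg y)) (show y ∈ _ by simp)
  rw [sub_zero, Real.norm_eq_abs] at this
  linarith

/-- `f` is `L`-Lipschitz, vanishes at `0`, and its first order Taylor expansion at `0` has a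
remainder of size at most `L ‖y‖²`. -/
structure IsTaylorLip {V : Type*} [NormedAddCommGroup V] [NormedSpace ℝ V] (L : ℝ) (f : V → ℝ) :
    Prop where
  nonneg : 0 ≤ L
  zero : f 0 = 0
  lip : ∀ x y, |f x - f y| ≤ L * ‖x - y‖
  taylor : ∃ p : V →L[ℝ] ℝ, ‖p‖ ≤ L ∧ ∀ y, |f y - p y| ≤ L * ‖y‖ ^ 2

section Calculus

variable {V : Type*} [NormedAddCommGroup V] [NormedSpace ℝ V] {f : V → ℝ}

theorem IsTaylorLip.of_fderiv {L : ℝ} (hf : Differentiable ℝ f) (h0 : f 0 = 0)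
    (h1 : ∀ y, ‖fderiv ℝ f y‖ ≤ L) (h2 : ∀ y, ‖fderiv ℝ f y - fderiv ℝ f 0‖ ≤ L * ‖y‖) :
    IsTaylorLip L f where
  nonneg := (norm_nonneg _).trans (h1 0)
  zero := h0
  lip x y := by
    simpa using convex_univ.norm_image_sub_le_of_norm_fderiv_le (𝕜 := ℝ) (f := f)
      (fun x _ => hf x) (fun x _ => h1 x) (Set.mem_univ y) (Set.mem_univ x)
  taylor := ⟨fderiv ℝ f 0, h1 0, fun y => by
    simpa [h0] using norm_sub_sub_fderiv_le hf ((norm_nonneg _).trans (h1 0)) h2 y⟩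

theorem IsTaylorLip.isLip {L : ℝ} (hf : IsTaylorLip L f) : IsLip f :=
  IsLip.of_le L fun x y => by rw [dist_eq_norm]; exact hf.lip x y

theorem IsTaylorLip.neg {L : ℝ} (hf : IsTaylorLip L f) : IsTaylorLip L (fun x => -f x) where
  nonneg := hf.nonneg
  zero := by simp [hf.zero]
  lip x y := by
    rw [neg_sub_neg, abs_sub_comm]
    exact hf.lip x y
  taylor := by
    obtain ⟨p, hp, h⟩ := hf.taylor
    refine ⟨-p, by simpa using hp, fun y => ?_⟩
    have := h y
    rwa [neg_apply, neg_sub_neg, abs_sub_comm]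

set_option maxSynthPendingDepth 3 in
-- The mixed difference has derivative `f'(x+y) - f'(y)` in `y`: it is of size `M‖x‖` by the bound
-- on `f''`, and `M‖x‖`-Lipschitz in `y` by the bound on `f'''`.
theorem IsCb.exists_isTaylorLip (hf : IsCb 3 f) (h0 : f 0 = 0) :
    ∃ M, IsTaylorLip M f ∧
      ∀ x, IsTaylorLip (M * ‖x‖) (fun y => f (x + y) - f x - f y) := by
  obtain ⟨hc, hb⟩ := hf
  obtain ⟨M₁, h₁⟩ := hb 1 (by norm_num)
  obtain ⟨M₂, h₂⟩ := hb 2 (by norm_num)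
  obtain ⟨M₃, h₃⟩ := hb 3 le_rfl
  have hd1 : Differentiable ℝ f := hc.differentiable (by norm_num)
  have hc2 : ContDiff ℝ 2 (fderiv ℝ f) := hc.fderiv_right (by norm_num)
  have hd2 : Differentiable ℝ (fderiv ℝ f) := hc2.differentiable (by norm_num)
  have hc3 : ContDiff ℝ 1 (fderiv ℝ (fderiv ℝ f)) := hc2.fderiv_right (by norm_num)
  have hd3 : Differentiable ℝ (fderiv ℝ (fderiv ℝ f)) := hc3.differentiable (by norm_num)
  have b1 : ∀ x, ‖fderiv ℝ f x‖ ≤ M₁ := fun x => by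
    simpa [norm_iteratedFDeriv_one] using h₁ x
  have b2 : ∀ x, ‖fderiv ℝ (fderiv ℝ f) x‖ ≤ M₂ := fun x => by
    have := h₂ x
    rwa [← norm_iteratedFDeriv_fderiv, norm_iteratedFDeriv_one] at this
  have b3 : ∀ x, ‖fderiv ℝ (fderiv ℝ (fderiv ℝ f)) x‖ ≤ M₃ := fun x => by
    have := h₃ x
    rwa [← norm_iteratedFDeriv_fderiv, ← norm_iteratedFDeriv_fderiv,
      norm_iteratedFDeriv_one] at this
  have l2 : ∀ x y, ‖fderiv ℝ f y - fderiv ℝ f x‖ ≤ M₂ * ‖y - x‖ := fun x y =>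
    convex_univ.norm_image_sub_le_of_norm_fderiv_le (𝕜 := ℝ) (fun x _ => hd2 x)
      (fun x _ => b2 x) (Set.mem_univ x) (Set.mem_univ y)
  have l3 : ∀ x y, ‖fderiv ℝ (fderiv ℝ f) y - fderiv ℝ (fderiv ℝ f) x‖ ≤ M₃ * ‖y - x‖ :=
    fun x y => convex_univ.norm_image_sub_le_of_norm_fderiv_le (𝕜 := ℝ) (fun x _ => hd3 x)
      (fun x _ => b3 x) (Set.mem_univ x) (Set.mem_univ y)
  set M := max M₁ (max M₂ M₃)
  have hM1 : M₁ ≤ M := le_max_left _ _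
  have hM2 : M₂ ≤ M := (le_max_left _ _).trans (le_max_right _ _)
  have hM3 : M₃ ≤ M := (le_max_right _ _).trans (le_max_right _ _)
  refine ⟨M, IsTaylorLip.of_fderiv hd1 h0 (fun y => (b1 y).trans hM1) fun y => ?_, fun x => ?_⟩
  · refine (l2 0 y).trans ?_
    rw [sub_zero]
    exact mul_le_mul_of_nonneg_right hM2 (norm_nonneg _)
  · have hfx : ∀ y, DifferentiableAt ℝ (fun y => f (x + y)) y := fun y =>
      (hd1.comp (differentiable_id.const_add x)) y
    have hfd : ∀ y, fderiv ℝ (fun y => f (x + y) - f x - f y) y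
        = fderiv ℝ f (x + y) - fderiv ℝ f y := fun y => by
      rw [fderiv_fun_sub ((hfx y).sub_const _) (hd1 y), fderiv_sub_const, fderiv_comp_add_left]
    have hfx' : ∀ y, DifferentiableAt ℝ (fun y => fderiv ℝ f (x + y)) y := fun y =>
      (hd2.comp (differentiable_id.const_add x)) y
    refine IsTaylorLip.of_fderiv (fun y => ((hfx y).sub_const _).sub (hd1 y)) (by simp [h0])
      (fun y => ?_) fun y => ?_
    · rw [hfd]
      refine (l2 y (x + y)).trans ?_
      rw [add_sub_cancel_right]
      exact mul_le_mul_of_nonneg_right hM2 (norm_nonneg _)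
    · rw [hfd, hfd]
      have := convex_univ.norm_image_sub_le_of_norm_fderiv_le (𝕜 := ℝ)
        (f := fun y => fderiv ℝ f (x + y) - fderiv ℝ f y) (C := M * ‖x‖)
        (fun y _ => (hfx' y).sub (hd2 y)) (fun y _ => ?_) (Set.mem_univ 0) (Set.mem_univ y)
      · simpa using this
      · rw [fderiv_fun_sub (hfx' y) (hd2 y), fderiv_comp_add_left (f := fderiv ℝ f)]
        refine (l3 y (x + y)).trans ?_
        rw [add_sub_cancel_right]
        exact mul_le_mul_of_nonneg_right hM3 (norm_nonneg _)

end Calculus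

/-! ### Small-time estimates for `G`-Lévy processes. -/

namespace SublinearExpectationSpace

theorem IsGLevyPair.exists_E_norm_le {Ω : Type*} {S : SublinearExpectationSpace Ω} {V : Type*}
    [NormedAddCommGroup V] [NormedSpace ℝ V] [FiniteDimensional ℝ V] {Xc Xd : ℝ≥0 → Ω → V}
    (h : S.IsGLevyPair Xc Xd) {η : ℝ} (hη : 0 < η) :
    ∃ ε : ℝ≥0, 0 < ε ∧ ∀ t ≤ ε, S.E (fun ω => ‖Xc t ω‖) ≤ η := by
  have hlev : S.IsLevy Xc := h.levy.map (ContinuousLinearMap.fst ℝ V V)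
  have hsmall : ∀ᶠ t : ℝ≥0 in 𝓝[>] 0, (t : ℝ) < η ^ 3 / 8 := by
    have : Tendsto (fun t : ℝ≥0 => (t : ℝ)) (𝓝[>] 0) (𝓝 0) :=
      (NNReal.continuous_coe.tendsto' 0 0 rfl).mono_left nhdsWithin_le_nhds
    exact this.eventually_lt_const (by positivity)
  have hev := (h.cube_lim.eventually_lt_const one_pos).and (h.cube_mem.and hsmall)
  obtain ⟨ε, hε, hsub⟩ := (mem_nhdsGT_iff_exists_Ioc_subset).1 hev
  refine ⟨ε, hε, fun t ht => ?_⟩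
  rcases eq_or_lt_of_le (zero_le (a := t)) with rfl | ht0
  · simpa [hlev.zero, S.const] using hη.le
  obtain ⟨h1, h2, h3⟩ := hsub ⟨ht0, ht⟩
  have ht0' : (0 : ℝ) < t := ht0
  rw [div_lt_one ht0'] at h1
  -- Splitting at `r = η/2` trades the first moment for the third, which is below `t < η³/8`.
  have hpt : ∀ r : ℝ, 0 ≤ r → r ≤ 4 / η ^ 2 * r ^ 3 + η / 2 := fun r hr => by
    rcases le_total r (η / 2) with h | h
    · have : 0 ≤ 4 / η ^ 2 * r ^ 3 := by positivity
      linarith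
    · have : r ≤ 4 / η ^ 2 * r ^ 3 := by
        rw [div_mul_eq_mul_div, le_div_iff₀ (by positivity)]
        have : η ^ 2 ≤ 4 * r ^ 2 := by nlinarith
        nlinarith
      linarith
  have h4 := S.mono _ (S.H.add_mem (S.mul_mem h2 (4 / η ^ 2)) (S.const_mem (η / 2))) _
    ((hlev.mem t).lip_mem IsLip.norm) fun ω => hpt ‖Xc t ω‖ (norm_nonneg _)
  have h5 := S.E_add_const (S.mul_mem h2 (4 / η ^ 2)) (η / 2)
  rw [S.E_mul h2 (by positivity)] at h5
  refine (h4.trans_eq h5).trans ?_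
  have h6 : 4 / η ^ 2 * S.E (fun ω => ‖Xc t ω‖ ^ 3) ≤ 4 / η ^ 2 * (η ^ 3 / 8) :=
    mul_le_mul_of_nonneg_left (by linarith) (by positivity)
  have h7 : 4 / η ^ 2 * (η ^ 3 / 8) = η / 2 := by field_simp; norm_num
  linarith

section GLevy

variable {Ω : Type u} {S : SublinearExpectationSpace Ω} {V : Type*}
    [NormedAddCommGroup V]

theorem IsGLevy.exists_E_norm_le [NormedSpace ℝ V] [FiniteDimensional ℝ V] {X : ℝ≥0 → Ω → V}
    (hX : S.IsGLevy X) {η : ℝ} (hη : 0 < η) :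
    ∃ ε : ℝ≥0, 0 < ε ∧ ∀ t ≤ ε, S.E (fun ω => ‖X t ω‖) ≤ η := by
  obtain ⟨Ω', S', Xc, Xd, hp, hd⟩ := hX.decomp
  obtain ⟨ε, hε, h⟩ := hp.exists_E_norm_le (half_pos hη)
  obtain ⟨C, hC⟩ := hp.jump_bound
  have hpos : 0 < η / 2 / (|C| + 1) := by positivity
  refine ⟨min ε (η / 2 / (|C| + 1)).toNNReal, lt_min hε (by simpa using hpos), fun t ht => ?_⟩
  have ht1 := h t (ht.trans (min_le_left _ _))
  have ht2 : (t : ℝ) ≤ η / 2 / (|C| + 1) := by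
    have := NNReal.coe_le_coe.2 (ht.trans (min_le_right _ _))
    rwa [Real.coe_toNNReal _ hpos.le] at this
  have hfd := hd 1 (fun _ => t) (fun x => ‖x 0‖) (IsLip.norm.comp (LipschitzWith.eval 0))
  simp only at hfd
  rw [hfd]
  have hmc := ((hp.levy.map (ContinuousLinearMap.fst ℝ V V)).mem t).lip_mem IsLip.norm
  have hmd := ((hp.levy.map (ContinuousLinearMap.snd ℝ V V)).mem t).lip_mem IsLip.norm
  have hms := ((hp.levy.map (ContinuousLinearMap.fst ℝ V V + ContinuousLinearMap.snd ℝ V V)).mem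
    t).lip_mem IsLip.norm
  have h1 := S'.mono _ (S'.H.add_mem hmc hmd) _ hms fun ω => norm_add_le _ _
  have h2 := S'.E_add_le hmc hmd
  have h3 := (h1.trans h2).trans (add_le_add ht1 (hC t))
  refine h3.trans ?_
  rw [le_div_iff₀ (by positivity)] at ht2
  nlinarith [le_abs_self C, t.2, mul_le_mul_of_nonneg_right (le_abs_self C) t.2]

/-- Small time bound for Taylor-Lipschitz functions, uniform in the function. -/
theorem IsGLevy.exists_E_le [InnerProductSpace ℝ V] [FiniteDimensional ℝ V] {X : ℝ≥0 → Ω → V}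
    (hX : S.IsGLevy X) :
    ∃ (C : ℝ) (ε : ℝ≥0), 0 ≤ C ∧ 0 < ε ∧ ∀ (L : ℝ) (g : V → ℝ), IsTaylorLip L g →
      ∀ s ≤ ε, S.E (fun ω => g (X s ω)) ≤ C * L * s := by
  have := FiniteDimensional.complete ℝ V
  obtain ⟨Ω', S', Xc, Xd, hp, hd⟩ := hX.decomp
  obtain ⟨ε, hε, h⟩ := hp.exists_E_norm_le (η := 1 / 6) (by norm_num)
  obtain ⟨C, hC⟩ := hp.jump_bound
  have hlc : S'.IsLevy Xc := hp.levy.map (ContinuousLinearMap.fst ℝ V V)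
  obtain ⟨K₁, hK₁, h₁⟩ := hlc.exists_E_inner_le hε fun t ht => (h t ht).trans (by norm_num)
  obtain ⟨K₂, hK₂, h₂⟩ := hlc.exists_E_softNorm_le hε h
  refine ⟨K₁ + 6 * K₂ + |C|, ε, by positivity, hε, fun L g hg s hs => ?_⟩
  obtain ⟨p, hpL, hpg⟩ := hg.taylor
  have hL := hg.nonneg
  have hfd := hd 1 (fun _ => s) (fun x => g (x 0)) (hg.isLip.comp (LipschitzWith.eval 0))
  simp only at hfd
  rw [hfd]
  set v := (InnerProductSpace.toDual ℝ V).symm p with hv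
  have hvp : ∀ y, inner ℝ v y = p y := fun y => by rw [hv, InnerProductSpace.toDual_symm_apply]
  have hvn : ‖v‖ ≤ L := by simpa [hv] using hpL
  -- The jump `d` is removed by the Lipschitz bound. The remainder `g c - p c` is at most `2L‖c‖`
  -- and at most `L‖c‖²`, whence `3 · 2L = 6L`.
  have hpt : ∀ c d : V, g (c + d) ≤ inner ℝ v c + (6 * L) * softNorm c + L * ‖d‖ := fun c d => by
    have e1 := (le_abs_self _).trans (hg.lip (c + d) c)
    rw [add_sub_cancel_left] at e1
    have e2 := (le_abs_self _).trans (hpg c)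
    have e3 := (le_abs_self _).trans (hg.lip c 0)
    rw [hg.zero, sub_zero, sub_zero] at e3
    have e4 := (neg_le_abs _).trans (p.le_opNorm c)
    have e5 := mul_le_mul_of_nonneg_right hpL (norm_nonneg c)
    have e6 : 0 ≤ L * ‖c‖ ^ 2 := by positivity
    have := le_softNorm (L := 2 * L) (r := g c - p c) (by linarith) c (by linarith) (by linarith)
    rw [hvp]
    linarith
  have hmc : (fun ω => inner ℝ v (Xc s ω)) ∈ S'.H := hlc.mem s (innerSL ℝ v)
  have hms := (hlc.mem s).lip_mem softNorm_isLip
  have hmd : (fun ω => ‖Xd s ω‖) ∈ S'.H :=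
    ((hp.levy.map (ContinuousLinearMap.snd ℝ V V)).mem s).lip_mem IsLip.norm
  have hmg := ((hp.levy.map (ContinuousLinearMap.fst ℝ V V + ContinuousLinearMap.snd ℝ V V)).mem
    s).lip_mem hg.isLip
  have q1 := S'.mono _ (S'.H.add_mem (S'.H.add_mem hmc (S'.mul_mem hms (6 * L)))
    (S'.mul_mem hmd L)) _ hmg fun ω => hpt (Xc s ω) (Xd s ω)
  have q2 := S'.E_add_le (S'.H.add_mem hmc (S'.mul_mem hms (6 * L))) (S'.mul_mem hmd L)
  have q3 := S'.E_add_le hmc (S'.mul_mem hms (6 * L))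
  rw [S'.E_mul hmd hL] at q2
  rw [S'.E_mul hms (by positivity)] at q3
  have q4 := h₁ v s hs
  have q5 := mul_le_mul_of_nonneg_left (h₂ s hs) (show 0 ≤ 6 * L by positivity)
  have q6 := mul_le_mul_of_nonneg_left (hC s) hL
  have q7 : K₁ * ‖v‖ * s ≤ K₁ * L * s :=
    mul_le_mul_of_nonneg_right (mul_le_mul_of_nonneg_left hvn hK₁) s.2
  have q8 : L * (C * s) ≤ L * (|C| * s) :=
    mul_le_mul_of_nonneg_left (mul_le_mul_of_nonneg_right (le_abs_self C) s.2) hL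
  have q9 := (q1.trans q2).trans (add_le_add_left q3 _)
  refine q9.trans ?_
  linarith [q4, q5, q6, q7, q8]

end GLevy

end SublinearExpectationSpace

/-! ### A Fekete lemma at `0`. -/

/-- Write `T = n s + r` with `r ≤ s` and add one step at a time: the errors sum to `η T`. Both
`a(r)` and the missing `r a(s)/s` cost at most `C s`. -/
theorem div_le_div_add_of_almost_subadditive {a : ℝ≥0 → ℝ} {C η : ℝ} {ε : ℝ≥0}
    (hC : ∀ t ≤ ε, |a t| ≤ C * t)
    (h : ∀ t s, t ≤ ε → s ≤ ε → a (t + s) ≤ a t + a s + η * s) {s T : ℝ≥0} (hs : 0 < s)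
    (hsT : s ≤ T) (hT : T ≤ ε) : a T / T ≤ a s / s + η + 2 * C * s / T := by
  have h0 : a 0 = 0 := by simpa using hC 0 (zero_le)
  have hs' : (0 : ℝ) < s := hs
  have hT' : (0 : ℝ) < T := hs.trans_le hsT
  have key : ∀ n : ℕ, n * s ≤ ε → a (n * s) ≤ n * (a s + η * s) := by
    intro n
    induction n with
    | zero => intro _; simp [h0]
    | succ n ih =>
      intro hn
      push_cast at hn ⊢
      rw [add_mul, one_mul] at hn ⊢
      have h1 := h (n * s) s (le_self_add.trans hn) (hsT.trans hT)
      have h2 := ih (le_self_add.trans hn)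
      linarith
  set n := ⌊(T : ℝ) / s⌋₊ with hn
  have hn2 : (n : ℝ) * s ≤ T := by
    have := Nat.floor_le (div_nonneg hT'.le hs'.le)
    rwa [le_div_iff₀ hs'] at this
  have hn3 : (T : ℝ) < (n + 1) * s := by
    have := Nat.lt_floor_add_one ((T : ℝ) / s)
    rwa [div_lt_iff₀ hs'] at this
  have hn2' : n * s ≤ T := by exact_mod_cast hn2
  obtain ⟨r, hr⟩ := exists_add_of_le hn2'
  have hr' : (T : ℝ) = n * s + r := by exact_mod_cast congrArg NNReal.toReal hr
  have hrT : r ≤ ε := (hr ▸ le_add_self : r ≤ T).trans hT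
  have h1 := h (n * s) r (hn2'.trans hT) hrT
  rw [← hr] at h1
  have h2 := key n (hn2'.trans hT)
  have h3 := (le_abs_self _).trans (hC r hrT)
  have h4 : |a s / s| ≤ C := by
    rw [abs_div, abs_of_pos hs', div_le_iff₀ hs']
    exact hC s (hsT.trans hT)
  have h5 : a s = a s / s * s := by field_simp
  have h6 := mul_le_mul_of_nonneg_left ((neg_le_abs _).trans h4) r.2
  have hC0 : 0 ≤ C := (abs_nonneg _).trans h4
  have h7 : C * r ≤ C * s := mul_le_mul_of_nonneg_left (by linarith) hC0
  have h8 : (n : ℝ) * a s = T * (a s / s) - r * (a s / s) := by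
    rw [hr']; nth_rewrite 1 [h5]; ring
  simp only [NNReal.val_eq_coe] at h6
  rw [div_le_iff₀ hT', add_mul, div_mul_cancel₀ _ hT'.ne']
  have h9 : η * T = η * (n * s) + η * r := by rw [hr']; ring
  linarith

/-- The Fekete lemma at `0`, for functions that are almost subadditive near `0`. -/
theorem exists_tendsto_div_of_almost_subadditive {a : ℝ≥0 → ℝ} {C : ℝ} {ε : ℝ≥0} (hε : 0 < ε)
    (hC : ∀ t ≤ ε, |a t| ≤ C * t)
    (h : ∀ η : ℝ, 0 < η → ∃ ε' : ℝ≥0, 0 < ε' ∧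
      ∀ t s, t ≤ ε' → s ≤ ε' → a (t + s) ≤ a t + a s + η * s) :
    ∃ ℓ : ℝ, Tendsto (fun t : ℝ≥0 => a t / t) (𝓝[>] 0) (𝓝 ℓ) := by
  have hIoc : ∀ δ : ℝ≥0, 0 < δ → ∀ᶠ t in 𝓝[>] (0 : ℝ≥0), 0 < t ∧ t ≤ δ := fun δ hδ =>
    Ioc_mem_nhdsGT hδ
  have hb : ∀ᶠ t in 𝓝[>] (0 : ℝ≥0), |a t / t| ≤ C := by
    filter_upwards [hIoc ε hε] with t ht
    have ht' : (0 : ℝ) < t := ht.1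
    rw [abs_div, abs_of_pos ht', div_le_iff₀ ht']
    exact hC t ht.2
  have hlow : IsBoundedUnder (· ≥ ·) (𝓝[>] 0) (fun t : ℝ≥0 => a t / t) :=
    ⟨-C, eventually_map.2 (hb.mono fun t ht => neg_le_of_abs_le ht)⟩
  have hup : IsBoundedUnder (· ≤ ·) (𝓝[>] 0) (fun t : ℝ≥0 => a t / t) :=
    ⟨C, eventually_map.2 (hb.mono fun t ht => le_of_abs_le ht)⟩
  refine ⟨liminf (fun t : ℝ≥0 => a t / t) (𝓝[>] 0), tendsto_order.2
    ⟨fun l hl => eventually_lt_of_lt_liminf hl hlow, fun l hl => ?_⟩⟩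
  obtain ⟨η, hη, hηl⟩ : ∃ η : ℝ, 0 < η ∧ liminf (fun t : ℝ≥0 => a t / t) (𝓝[>] 0) + 3 * η = l :=
    ⟨(l - liminf (fun t : ℝ≥0 => a t / t) (𝓝[>] 0)) / 3, by linarith, by ring⟩
  obtain ⟨ε', hε', hsub⟩ := h η hη
  -- `T` is fixed and `s` is chosen much smaller, with `a(s)/s` within `η` of the liminf; the other
  -- two `η` absorb the subadditivity error and `2Cs/T`.
  have hfreq := frequently_lt_of_liminf_lt (b := l - 2 * η) hup.isCoboundedUnder_ge (by linarith)
  filter_upwards [hIoc _ (lt_min hε hε')] with T hT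
  have hT0 : (0 : ℝ) < T := hT.1
  have hsmall : ∀ᶠ s : ℝ≥0 in 𝓝[>] 0, 2 * C * s / T < η := by
    have : Tendsto (fun s : ℝ≥0 => 2 * C * s / T) (𝓝[>] 0) (𝓝 0) :=
      (Continuous.tendsto' (by fun_prop) 0 0 (by simp)).mono_left nhdsWithin_le_nhds
    exact this.eventually_lt_const hη
  obtain ⟨s, hs1, hs2, hs3⟩ := (hfreq.and_eventually (hsmall.and (hIoc T hT.1))).exists
  have := div_le_div_add_of_almost_subadditive
    (fun t ht => hC t (ht.trans (min_le_left _ _)))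
    (fun t s ht hs => hsub t s (ht.trans (min_le_right _ _)) (hs.trans (min_le_right _ _)))
    hs3.1 hs3.2 hT.2
  linarith

/-! ### Existence of the generator limit. -/

namespace SublinearExpectationSpace

variable {Ω : Type u} {S : SublinearExpectationSpace Ω} {V : Type*}
    [NormedAddCommGroup V] [InnerProductSpace ℝ V] [FiniteDimensional ℝ V] {X : ℝ≥0 → Ω → V}

theorem IsGLevy.tendsto_generator (hX : S.IsGLevy X) {f : V → ℝ} (hf : IsCb 3 f) (h0 : f 0 = 0) :
    Tendsto (fun δ : ℝ≥0 => S.E (fun ω => f (X δ ω)) / (δ : ℝ)) (𝓝[>] 0)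
      (𝓝 (S.generator X f)) := by
  obtain ⟨C, ε, hC, hε, hE⟩ := hX.exists_E_le
  obtain ⟨M, hfM, hg⟩ := hf.exists_isTaylorLip h0
  have hmem := hX.levy.mem
  have hfl := hfM.isLip
  refine tendsto_nhds_limUnder (exists_tendsto_div_of_almost_subadditive (C := C * M) hε
    (fun t ht => abs_le.2 ⟨?_, hE M f hfM t ht⟩) fun η hη => ?_)
  -- The lower bound is the upper bound for `-f`, as `-E[-f] ≤ E[f]`.
  · have h1 := hE M _ hfM.neg t ht
    have h2 := S.neg_E_neg_le ((hmem t).lip_mem hfl)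
    linarith
  have hCM : 0 ≤ C * M := mul_nonneg hC hfM.nonneg
  obtain ⟨ε', hε', hn⟩ := hX.exists_E_norm_le (η := η / (C * M + 1)) (by positivity)
  refine ⟨min ε ε', lt_min hε hε', fun t s ht hs => ?_⟩
  have hsε := hs.trans (min_le_left _ _)
  have htn := hn t (ht.trans (min_le_right _ _))
  have hin : ∀ x, S.E (fun ω => f (x + X s ω)) ≤
      f x + C * M * s * ‖x‖ + S.E (fun ω => f (X s ω)) := fun x => by
    have hgm := (hmem s).lip_mem (hg x).isLip
    have h1 := hE _ _ (hg x) s hsε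
    have h2 := S.E_add_le (S.H.add_mem ((hmem s).lip_mem hfl) hgm) (S.const_mem (f x))
    have h3 := S.E_add_le ((hmem s).lip_mem hfl) hgm
    rw [S.const] at h2
    have h4 : (fun ω => f (x + X s ω)) =
        fun ω => f (X s ω) + (f (x + X s ω) - f x - f (X s ω)) + f x := by
      ext ω
      ring
    rw [h4]
    change S.E (fun ω => _ + _ + _) ≤ S.E (fun ω => _ + _) + _ at h2
    linarith
  have hL : IsLip (fun x : V => f x + C * M * s * ‖x‖) := hfl.add (IsLip.norm.const_mul _)
  have h1 := S.mono _ ((hmem t).lip_mem (hL.add (IsLip.const _))) _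
    ((hmem t).lip_mem ((hmem s).isLip_E_add hfl)) fun ω => hin (X t ω)
  rw [hX.levy.E_add t s hfl]
  refine h1.trans ?_
  rw [S.E_add_const ((hmem t).lip_mem hL)]
  have hnm := (hmem t).lip_mem IsLip.norm
  have h2 := S.E_add_le ((hmem t).lip_mem hfl) (S.mul_mem hnm (C * M * s))
  rw [S.E_mul hnm (by positivity)] at h2
  have h3 : C * M * s * S.E (fun ω => ‖X t ω‖) ≤ η * s := by
    have := mul_le_mul_of_nonneg_left htn (show 0 ≤ C * M * s by positivity)
    refine this.trans ?_
    rw [mul_div_assoc', div_le_iff₀ (by positivity)]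
    have : 0 ≤ η * s := by positivity
    nlinarith
  linarith

end SublinearExpectationSpace

/-! ### Test functions. -/

theorem IsCb.shift_sub_const {V : Type*} [NormedAddCommGroup V] [NormedSpace ℝ V] {k : ℕ}
    {f : V → ℝ} (hf : IsCb k f) (x : V) (c : ℝ) : IsCb k (fun z => f (x + z) - c) := by
  have hs : ContDiff ℝ k (fun z => f (x + z)) := hf.1.comp (contDiff_const.add contDiff_id)
  refine ⟨hs.sub contDiff_const, fun j hj => ?_⟩
  obtain ⟨M, hM⟩ := hf.2 j hj
  have hj' : (j : WithTop ℕ∞) ≤ k := by exact_mod_cast hj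
  refine ⟨M + |c|, fun z => ?_⟩
  rw [fun_iteratedFDeriv_sub_apply (hs.of_le hj').contDiffAt contDiff_const.contDiffAt,
    iteratedFDeriv_comp_add_left]
  refine (norm_sub_le _ _).trans (add_le_add (hM _) ?_)
  rcases eq_or_ne j 0 with rfl | hj0
  · simp
  · rw [iteratedFDeriv_const_of_ne hj0]
    simp

theorem IsCb23.isCb {V : Type*} [NormedAddCommGroup V] [NormedSpace ℝ V] {ψ : ℝ → V → ℝ}
    (hψ : IsCb23 ψ) {t : ℝ} (ht : 0 < t) : IsCb 3 (ψ t) :=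
  ⟨hψ.contDiff_space t ht, fun j hj => (hψ.space_bdd j hj).imp fun _ hM => hM t ht⟩

/-- First order expansion in time of a `C_b^{2,3}` function, locally uniform in space. -/
theorem IsCb23.exists_time_expansion {V : Type*} [NormedAddCommGroup V] [NormedSpace ℝ V]
    {ψ : ℝ → V → ℝ} (hψ : IsCb23 ψ) {t : ℝ} (ht : 0 < t) (x : V) {ε : ℝ} (hε : 0 < ε) :
    ∃ η K : ℝ, 0 < η ∧ 0 ≤ K ∧ ∀ δ : ℝ, 0 < δ → δ < η → ∀ z,
      |ψ (t - δ) z - ψ t z + δ * deriv (fun s => ψ s x) t| ≤ δ * (ε + K * ‖z - x‖) := by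
  obtain ⟨M, hM⟩ := hψ.time_bdd 1 (by norm_num)
  have hc := hψ.time_cont 1 (by norm_num)
  simp only [iteratedDeriv_one] at hM hc
  have hca := hc.continuousAt (x := (t, x))
    (prod_mem_nhds (Ioi_mem_nhds ht) univ_mem)
  obtain ⟨ρ, hρ, hcont⟩ := Metric.continuousAt_iff.1 hca ε hε
  have hM0 : 0 ≤ M := (abs_nonneg _).trans (hM t ht x)
  set c := deriv (fun s => ψ s x) t with hcdef
  refine ⟨min ρ t, 2 * M / ρ, lt_min hρ ht, by positivity, fun δ hδ hδη z => ?_⟩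
  have hδρ := hδη.trans_le (min_le_left _ _)
  have hδt := hδη.trans_le (min_le_right _ _)
  have hpos : ∀ s ∈ Set.Icc (t - δ) t, 0 < s := fun s hs => by linarith [hs.1]
  have hdiff : ∀ s ∈ Set.Icc (t - δ) t, DifferentiableAt ℝ (fun s => ψ s z) s := fun s hs =>
    ((hψ.contDiff_time z).differentiableOn (by norm_num)).differentiableAt
      (Ioi_mem_nhds (hpos s hs))
  have hbound : ∀ s ∈ Set.Icc (t - δ) t, ‖deriv (fun s => ψ s z - s * c) s‖ ≤
      ε + 2 * M / ρ * ‖z - x‖ := by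
    intro s hs
    rw [deriv_fun_sub (hdiff s hs) (by fun_prop), deriv_mul_const (by fun_prop), deriv_id'', one_mul,
      Real.norm_eq_abs]
    have hK : 0 ≤ 2 * M / ρ * ‖z - x‖ := by positivity
    -- Near `x`, continuity of the time derivative gives `ε`; at distance at least `ρ`, the crude
    -- bound `2M` is absorbed by `(2M/ρ)‖z - x‖`.
    rcases lt_or_ge ‖z - x‖ ρ with hz | hz
    · have : dist (s, z) (t, x) < ρ := by
        rw [Prod.dist_eq, max_lt_iff, Real.dist_eq, dist_eq_norm, abs_lt]
        exact ⟨⟨by linarith [hs.1], by linarith [hs.2]⟩, hz⟩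
      have := hcont this
      rw [Real.dist_eq] at this
      linarith
    · have h1 := hM s (hpos s hs) z
      have h2 := hM t ht x
      have h3 := abs_sub (deriv (fun s => ψ s z) s) c
      have h4 : 2 * M ≤ 2 * M / ρ * ‖z - x‖ := by
        rw [div_mul_eq_mul_div, le_div_iff₀ hρ]
        exact mul_le_mul_of_nonneg_left hz (by positivity)
      linarith
  have := (convex_Icc (t - δ) t).norm_image_sub_le_of_norm_deriv_le
    (fun s hs => (hdiff s hs).sub (by fun_prop)) hbound
    (Set.right_mem_Icc.2 (by linarith)) (Set.left_mem_Icc.2 (by linarith))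
  rw [Real.norm_eq_abs, Real.norm_eq_abs, sub_sub_cancel_left, abs_neg, abs_of_pos hδ,
    mul_comm] at this
  convert this using 2
  simp only [Pi.sub_apply]
  ring

/-! ### The semigroup and its continuity. -/

namespace SublinearExpectationSpace

variable {Ω : Type u} {S : SublinearExpectationSpace Ω} {V : Type*} [NormedAddCommGroup V]

section Semigroup

variable [NormedSpace ℝ V] {X : ℝ≥0 → Ω → V} {φ : V → ℝ}

theorem IsLevy.dynamic_programming (hX : S.IsLevy X) (hφ : IsLip φ) (t s : ℝ≥0) (x : V) :
    S.E (fun ω => φ (x + X (s + t) ω)) =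
      S.E (fun ω => S.E (fun ω' => φ (x + X s ω + X t ω'))) := by
  simpa [add_assoc] using hX.E_add s t (hφ.const_add x)

variable [FiniteDimensional ℝ V]

theorem IsLevy.abs_E_sub_le (hX : S.IsLevy X) {L : ℝ}
    (hL : ∀ x y, |φ x - φ y| ≤ L * dist x y) (t : ℝ≥0) (x y : V) :
    |S.E (fun ω => φ (x + X t ω)) - S.E (fun ω => φ (y + X t ω))| ≤ L * ‖x - y‖ := by
  have hφ := IsLip.of_le L hL
  rw [← S.const (L * ‖x - y‖)]
  refine S.abs_E_sub_le ((hX.mem t).lip_mem (hφ.const_add x))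
    ((hX.mem t).lip_mem (hφ.const_add y)) (S.const_mem _) fun ω => ?_
  simpa [dist_eq_norm] using hL (x + X t ω) (y + X t ω)

theorem IsLevy.abs_E_add_sub_le (hX : S.IsLevy X) {L : ℝ} (hL0 : 0 ≤ L)
    (hL : ∀ x y, |φ x - φ y| ≤ L * dist x y) (t s : ℝ≥0) (x : V) :
    |S.E (fun ω => φ (x + X (t + s) ω)) - S.E (fun ω => φ (x + X t ω))| ≤
      L * S.E (fun ω => ‖X s ω‖) := by
  have hφ := IsLip.of_le L hL
  have hn := (hX.mem s).lip_mem IsLip.norm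
  -- The short step `s` is run first, so that the spatial Lipschitz bound of `E[φ(· + X_t)]`
  -- controls the time increment.
  rw [add_comm, hX.dynamic_programming hφ, ← S.E_mul hn hL0,
    ← S.const (S.E (fun ω => φ (x + X t ω)))]
  refine S.abs_E_sub_le
    ((hX.mem s).lip_mem (((hX.mem t).isLip_E_add hφ).const_add x)) (S.const_mem _)
    (S.mul_mem hn L) fun ω => ?_
  simpa using hX.abs_E_sub_le hL t (x + X s ω) x

theorem IsGLevy.continuous_semigroup (hX : S.IsGLevy X) (hφ : IsLip φ) :
    Continuous (fun p : ℝ≥0 × V => S.E (fun ω => φ (p.2 + X p.1 ω))) := by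
  obtain ⟨L, hL0, hL⟩ := hφ.exists_le
  refine Metric.continuous_iff.2 fun p ε hε => ?_
  obtain ⟨δ, hδ, hδE⟩ := hX.exists_E_norm_le (η := ε / (2 * (L + 1))) (by positivity)
  have hδ' : (0 : ℝ) < δ := hδ
  have htime : ∀ (t t' : ℝ≥0) (x : V), dist t t' < δ →
      |S.E (fun ω => φ (x + X t ω)) - S.E (fun ω => φ (x + X t' ω))| ≤
        L * (ε / (2 * (L + 1))) := by
    have key : ∀ (t t' : ℝ≥0) (x : V), t' ≤ t → dist t t' < δ →
        |S.E (fun ω => φ (x + X t ω)) - S.E (fun ω => φ (x + X t' ω))| ≤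
          L * (ε / (2 * (L + 1))) := by
      intro t t' x htt hd
      obtain ⟨s, rfl⟩ := exists_add_of_le htt
      have hs : s ≤ δ := by
        rw [NNReal.dist_eq, NNReal.coe_add, add_sub_cancel_left, abs_of_nonneg s.coe_nonneg] at hd
        exact_mod_cast hd.le
      exact (hX.levy.abs_E_add_sub_le hL0 hL t' s x).trans
        (mul_le_mul_of_nonneg_left (hδE s hs) hL0)
    intro t t' x hd
    rcases le_total t' t with h | h
    · exact key t t' x h hd
    · rw [abs_sub_comm]
      exact key t' t x h (dist_comm t t' ▸ hd)
  have hr : 0 < ε / (2 * (L + 1)) := by positivity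
  refine ⟨min δ (ε / (2 * (L + 1))), lt_min hδ' hr, fun q hq => ?_⟩
  rw [Prod.dist_eq, max_lt_iff, lt_min_iff, lt_min_iff] at hq
  rw [Real.dist_eq]
  have h1 := htime q.1 p.1 q.2 hq.1.1
  have h2 := hX.levy.abs_E_sub_le hL p.1 q.2 p.2
  rw [← dist_eq_norm] at h2
  have h3 := mul_le_mul_of_nonneg_left hq.2.2.le hL0
  have h4 : L * (ε / (2 * (L + 1))) < ε / 2 := by
    rw [mul_div_assoc', div_lt_div_iff₀ (by positivity) two_pos]
    nlinarith
  refine (abs_sub_le _ (S.E (fun ω => φ (q.2 + X p.1 ω))) _).trans_lt ?_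
  linarith

end Semigroup

/-! ### The viscosity inequalities. -/

section Viscosity

variable [InnerProductSpace ℝ V] [FiniteDimensional ℝ V] {X : ℝ≥0 → Ω → V} {φ : V → ℝ}

/-- Small time expansion of a test function, together with what is needed of the time step. -/
theorem IsGLevy.eventually_expansion (hX : S.IsGLevy X) {ψ : ℝ → V → ℝ} (hψ : IsCb23 ψ)
    {t : ℝ≥0} (ht : 0 < t) (x : V) {ε : ℝ} (hε : 0 < ε) :
    ∃ K : ℝ, 0 ≤ K ∧ ∀ᶠ δ : ℝ≥0 in 𝓝[>] 0, 0 < δ ∧ K * S.E (fun ω => ‖X δ ω‖) ≤ ε ∧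
      ∃ r : ℝ≥0, 0 < r ∧ δ + r = t ∧ ∀ y,
        |ψ r (x + y) - ψ t (x + y) + δ * deriv (fun s => ψ s x) t| ≤ δ * (ε + K * ‖y‖) := by
  obtain ⟨η, K, hη, hK, hexp⟩ := hψ.exists_time_expansion (t := t) ht x hε
  obtain ⟨δ₀, hδ₀, hn⟩ := hX.exists_E_norm_le (η := ε / (K + 1)) (by positivity)
  have hcoe : Tendsto (fun t : ℝ≥0 => (t : ℝ)) (𝓝[>] 0) (𝓝 0) :=
    (NNReal.continuous_coe.tendsto' 0 0 rfl).mono_left nhdsWithin_le_nhds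
  refine ⟨K, hK, ?_⟩
  filter_upwards [Ioc_mem_nhdsGT hδ₀, Ioo_mem_nhdsGT ht, hcoe.eventually_lt_const hη]
    with δ h1 h2 h3
  refine ⟨h1.1, ?_, t - δ, tsub_pos_of_lt h2.2, add_tsub_cancel_of_le h2.2.le, fun y => ?_⟩
  · have := mul_le_mul_of_nonneg_left (hn δ h1.2) hK
    refine this.trans ?_
    rw [mul_div_assoc', div_le_iff₀ (by positivity)]
    nlinarith
  · rw [NNReal.coe_sub h2.2.le]
    simpa using hexp δ h1.1 h3 (x + y)

theorem IsGLevy.deriv_sub_generator_nonpos (hX : S.IsGLevy X) (hφ : IsLip φ) {t : ℝ≥0}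
    (ht : 0 < t) (x : V) {ψ : ℝ → V → ℝ} (hψ : IsCb23 ψ)
    (hle : ∀ (s : ℝ≥0) (y : V), 0 < s → S.E (fun ω => φ (y + X s ω)) ≤ ψ s y)
    (heq : ψ t x = S.E (fun ω => φ (x + X t ω))) :
    deriv (fun s => ψ s x) t - S.generator X (fun z => ψ t (x + z) - ψ t x) ≤ 0 := by
  have hcb := (hψ.isCb (t := t) ht).shift_sub_const x (ψ t x)
  have hlim := hX.tendsto_generator hcb (by simp)
  have hfl : IsLip (fun z => ψ t (x + z) - ψ t x) :=
    (hcb.exists_isTaylorLip (by simp)).choose_spec.1.isLip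
  rw [sub_nonpos]
  refine le_of_forall_pos_le_add fun ε hε => ?_
  obtain ⟨K, hK, hev⟩ := hX.eventually_expansion hψ ht x (half_pos hε)
  rw [← sub_le_iff_le_add]
  refine ge_of_tendsto hlim (hev.mono fun δ h => ?_)
  obtain ⟨hδ, hKE, r, hr, rfl, hexp⟩ := h
  have hδ' : (0 : ℝ) < δ := hδ
  have hm := hX.levy.mem δ
  rw [hX.levy.dynamic_programming hφ] at heq
  set c := deriv (fun s => ψ s x) ((δ + r : ℝ≥0) : ℝ)
  have hL : IsLip (fun z => (ψ (δ + r : ℝ≥0) (x + z) - ψ (δ + r : ℝ≥0) x) + δ * K * ‖z‖) :=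
    hfl.add (IsLip.norm.const_mul _)
  -- By `heq` the left side has expectation `ψ(t, x)`, which cancels. Half of `ε` pays for the time
  -- expansion, half for `K E‖X_δ‖`.
  have h1 := S.mono _ (hm.lip_mem (hL.add
      (IsLip.const (ψ (δ + r : ℝ≥0) x - δ * c + δ * (ε / 2))))) _
    (hm.lip_mem (((hX.levy.mem r).isLip_E_add hφ).const_add x)) fun ω => by
      have h1 := hle r (x + X δ ω) hr
      have h2 := (le_abs_self _).trans (hexp (X δ ω))
      linarith
  rw [S.E_add_const (hm.lip_mem hL)] at h1
  have h2 := S.E_add_le (hm.lip_mem hfl) (S.mul_mem (hm.lip_mem IsLip.norm) (δ * K))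
  rw [S.E_mul (hm.lip_mem IsLip.norm) (by positivity)] at h2
  have h3 := mul_le_mul_of_nonneg_left hKE hδ'.le
  rw [le_div_iff₀ hδ']
  linarith

theorem IsGLevy.deriv_sub_generator_nonneg (hX : S.IsGLevy X) (hφ : IsLip φ) {t : ℝ≥0}
    (ht : 0 < t) (x : V) {ψ : ℝ → V → ℝ} (hψ : IsCb23 ψ)
    (hle : ∀ (s : ℝ≥0) (y : V), 0 < s → ψ s y ≤ S.E (fun ω => φ (y + X s ω)))
    (heq : ψ t x = S.E (fun ω => φ (x + X t ω))) :
    0 ≤ deriv (fun s => ψ s x) t - S.generator X (fun z => ψ t (x + z) - ψ t x) := by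
  have hcb := (hψ.isCb (t := t) ht).shift_sub_const x (ψ t x)
  have hlim := hX.tendsto_generator hcb (by simp)
  have hfl : IsLip (fun z => ψ t (x + z) - ψ t x) :=
    (hcb.exists_isTaylorLip (by simp)).choose_spec.1.isLip
  rw [sub_nonneg]
  refine le_of_forall_pos_le_add fun ε hε => ?_
  obtain ⟨K, hK, hev⟩ := hX.eventually_expansion hψ ht x (half_pos hε)
  refine le_of_tendsto hlim (hev.mono fun δ h => ?_)
  obtain ⟨hδ, hKE, r, hr, rfl, hexp⟩ := h
  have hδ' : (0 : ℝ) < δ := hδ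
  have hm := hX.levy.mem δ
  rw [hX.levy.dynamic_programming hφ] at heq
  set c := deriv (fun s => ψ s x) ((δ + r : ℝ≥0) : ℝ)
  have hu := hm.lip_mem (((hX.levy.mem r).isLip_E_add hφ).const_add x)
  have hn := S.mul_mem (hm.lip_mem IsLip.norm) (δ * K)
  -- The error `δK‖X_δ‖` is put on the side of `u`, where subadditivity splits it off in the right
  -- direction.
  have h1 := S.mono _ (S.H.add_mem hu hn) _
    (hm.lip_mem (hfl.add (IsLip.const (ψ (δ + r : ℝ≥0) x - δ * c - δ * (ε / 2))))) fun ω => by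
      have h1 := hle r (x + X δ ω) hr
      have h2 := (neg_le_abs _).trans (hexp (X δ ω))
      simp only [Pi.add_apply]
      linarith
  rw [S.E_add_const (hm.lip_mem hfl)] at h1
  have h2 := h1.trans (S.E_add_le hu hn)
  rw [S.E_mul (hm.lip_mem IsLip.norm) (by positivity)] at h2
  have h3 := mul_le_mul_of_nonneg_left hKE hδ'.le
  rw [div_le_iff₀ hδ']
  linarith

theorem IsGLevy.isViscositySolution (hX : S.IsGLevy X) (hφ : IsBddLip φ) :
    IsViscositySolution (S.generator X) φ (fun t x => S.E (fun ω => φ (x + X t ω))) := by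
  obtain ⟨hl, M, hM⟩ := hφ
  have hbdd : ∃ M : ℝ, ∀ (t : ℝ≥0) x, |S.E (fun ω => φ (x + X t ω))| ≤ M := ⟨M, fun t x => by
    simpa [S.const] using S.abs_E_sub_le ((hX.levy.mem t).lip_mem (hl.const_add x))
      (S.const_mem 0) (S.const_mem M) fun ω => by simpa using hM _⟩
  have hcont := hX.continuous_semigroup hl
  have hinit : ∀ x, S.E (fun ω => φ (x + X 0 ω)) = φ x := fun x => by
    simp [hX.levy.zero, S.const]
  exact
    { bdd := hbdd
      cont := hcont
      sub :=
        { bdd := hbdd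
          usc := hcont.upperSemicontinuous
          init := fun x => (hinit x).le
          sub := fun t x ht ψ hψ hle heq =>
            hX.deriv_sub_generator_nonpos hl ht x hψ hle heq }
      super :=
        { bdd := hbdd
          lsc := hcont.lowerSemicontinuous
          init := fun x => (hinit x).ge
          super := fun t x ht ψ hψ hle heq =>
            hX.deriv_sub_generator_nonneg hl ht x hψ hle heq } }

end Viscosity

end SublinearExpectationSpace

theorem mainTheorem2 {Ω : Type u} (S : SublinearExpectationSpace Ω) (d : ℕ)
    (X : ℝ≥0 → Ω → EuclideanSpace ℝ (Fin d)) (hX : S.IsGLevy X) :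
    (∀ f : EuclideanSpace ℝ (Fin d) → ℝ, IsCb 3 f → f 0 = 0 →
      Tendsto (fun δ : ℝ≥0 => S.E (fun ω => f (X δ ω)) / (δ : ℝ)) (𝓝[>] 0)
        (𝓝 (S.generator X f))) ∧
    ∀ φ : EuclideanSpace ℝ (Fin d) → ℝ, IsBddLip φ →
      IsViscositySolution (S.generator X) φ (fun t x => S.E (fun ω => φ (x + X t ω))) :=
  ⟨fun _ hf h0 => hX.tendsto_generator hf h0, fun _ hφ => hX.isViscositySolution hφ⟩
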